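/- Let $N\in\mathbb N$, let $k\ge 1$ and $0\le \ell\le k-1$ be integers, let $1<p<q<\infty$ and let $\lambda\in\mathbb R$ satisfy $-\ell\le\lambda\le\frac{kp-\ell q}{q-p}$. For $\rho>0$ and a locally integrable function $u:\mathbb R^N\to\mathbb R$, let \[ |u|_{\mathcal L^{1,\lambda}_{\ell,\rho}}=\sup_{x\in\mathbb R^N,\;0<r<\rho} r^{\lambda}\inf_{P}\frac{1}{|B_r(x)|}\int_{B_r(x)}|u-P|, \] where the infimum is taken over the real polynomials $P$ on $\mathbb R^N$ of degree at most $\ell-1$ (only $P=0$ if $\ell=0$); $u$ belongs to the localized Campanato space $\mathcal L^{1,\lambda}_{\ell,\rho}(\mathbb R^N)$ if this quantity is finite. Let $D^ju$ denote the weak derivative of order $j$ of $u$, a function with values in the $j$-linear forms on $\mathbb R^N$, and let $|D^ju|$ be its operator norm. Then there is a constant $C$, depending only on $N,k,\ell,p,q,\lambda$, such that for every $\rho>0$ and every $u\in W^{k,p}(\mathbb R^N)\cap\mathcal L^{1,\lambda}_{\ell,\rho}(\mathbb R^N)$ one has $D^\ell u\in L^q(\mathbb R^N)$ and \[ \int_{\mathbb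 R^N}\rho^{\ell q}|D^\ell u|^q\le C\bigl(\rho^{-\lambda}|u|_{\mathcal L^{1,\lambda}_{\ell,\rho}}\bigr)^{q-p}\int_{\mathbb R^N}\bigl(\rho^{kp}|D^ku|^p+\rho^{\ell p}|D^\ell u|^p\bigr). \] -/

import Mathlib

open MeasureTheory Set
open scoped ENNReal NNReal ContDiff

/-- `g` is the weak derivative `D^j u` of order `j` of the locally integrable function
`u : ℝ^N → ℝ`, as a field of `j`-linear forms: for every smooth compactly supported `φ`,
`∫ u D^j φ = (-1)^j ∫ φ g`. The size `|D^j u|` is the operator norm of the multilinear form. -/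
def HasWeakDeriv {N : ℕ} (j : ℕ) (u : EuclideanSpace ℝ (Fin N) → ℝ)
    (g : EuclideanSpace ℝ (Fin N) → (EuclideanSpace ℝ (Fin N)) [×j]→L[ℝ] ℝ) : Prop :=
  LocallyIntegrable u volume ∧ LocallyIntegrable g volume ∧
    ∀ φ : EuclideanSpace ℝ (Fin N) → ℝ, ContDiff ℝ ∞ φ → HasCompactSupport φ →
      ∫ x, u x • iteratedFDeriv ℝ j φ x = (-1 : ℝ) ^ j • ∫ x, φ x • g x

/-- `u ∈ W^{k,p}(ℝ^N)`: `u ∈ L^p` and all weak derivatives of order at most `k` exist and belong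
to `L^p`. -/
def MemSobolev {N : ℕ} (k : ℕ) (p : ℝ) (u : EuclideanSpace ℝ (Fin N) → ℝ) : Prop :=
  MemLp u (ENNReal.ofReal p) volume ∧
    ∀ j ≤ k, ∃ g : EuclideanSpace ℝ (Fin N) → (EuclideanSpace ℝ (Fin N)) [×j]→L[ℝ] ℝ,
      HasWeakDeriv j u g ∧ MemLp g (ENNReal.ofReal p) volume

/-- The real polynomials on `ℝ^N` of degree less than `ℓ` (only the zero polynomial if `ℓ = 0`). -/
def polysDegreeLT (N ℓ : ℕ) : Set (MvPolynomial (Fin N) ℝ) :=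
  {P | P = 0 ∨ P.totalDegree < ℓ}

/-- The localized Campanato seminorm with integrability exponent `1`,
`|u|_{L^{1,lam}_{ℓ,ρ}} = sup_{x, 0 < r < ρ} r^lam inf_{deg P < ℓ} ⨍_{B_r(x)} |u - P|`,
with values in `[0, ∞]`. -/
noncomputable def campanatoSeminorm {N : ℕ} (lam : ℝ) (ℓ : ℕ) (ρ : ℝ)
    (u : EuclideanSpace ℝ (Fin N) → ℝ) : ℝ≥0∞ :=
  ⨆ (x : EuclideanSpace ℝ (Fin N)) (r ∈ Ioo (0 : ℝ) ρ),
    ENNReal.ofReal (r ^ lam) *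
      ⨅ P ∈ polysDegreeLT N ℓ,
        ⨍⁻ y in Metric.ball x r, ‖u y - MvPolynomial.eval (fun i => y i) P‖ₑ ∂volume

/-- `u` belongs to the localized Campanato space `L^{1,lam}_{ℓ,ρ}(ℝ^N)`. -/
def MemCampanato {N : ℕ} (lam : ℝ) (ℓ : ℕ) (ρ : ℝ)
    (u : EuclideanSpace ℝ (Fin N) → ℝ) : Prop :=
  LocallyIntegrable u volume ∧ campanatoSeminorm lam ℓ ρ u < ⊤

/-! Write `n = k - ℓ`. The theorem follows from a pointwise bound at each scale `0 < t < ρ`: for a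
mollification `f` of `D^ℓ u`, `|f(x)| ≤ C (t ^ n * M(x) + t ^ (-(ℓ + lam)) * B)`, where `M` is the
maximal function of the equally mollified `D^k u` and `B` is the Campanato seminorm of `u`.

To obtain it, average the `n`-th finite difference of `f` at `x` with step `-(t / n) z` against a
normalised bump in `z`. The zeroth term is `±f(x)`. The whole difference is an integral of `D^k u`
along a segment, which averages to `t ^ n * M(x)`. The other terms are averages of `D^ℓ u` at scales
between `t / n` and `t`; moving the `ℓ` derivatives onto the bump allows any polynomial of degree
below `ℓ` to be subtracted from `u`, hence the factor `B`
(`exists_enorm_mollify_le_maximalFunction`).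

Optimising in `t` turns this family of bounds into a pointwise inequality between powers
(`rpow_le_of_forall_le_add`); the restriction `t < ρ` produces the lower order term, and the upper
bound on `lam` makes the exponents fit. Integration uses the `L^p` bound for the maximal function
and Jensen's inequality for mollifiers. All constants are independent of the mollifier, so Fatou's
lemma removes it. -/

/-! ### The local maximal function and its weak and strong type bounds. -/

section MaximalFunction

open Metric Module Measure

variable {E : Type*} [NormedAddCommGroup E] [MeasurableSpace E] [BorelSpace E]

/-- The centred Hardy–Littlewood maximal function over balls of radius at most `R`. -/
noncomputable def maximalFunction (μ : Measure E) (R : ℝ) (F : E → ℝ≥0∞) (x : E) : ℝ≥0∞ :=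
  ⨆ s ∈ Ioc (0 : ℝ) R, (∫⁻ y in ball x s, F y ∂μ) / μ (ball x s)

/-- An open ball is the increasing union of smaller concentric balls, so a slightly smaller one
already carries mass above `c`, and it lies in every ball of radius `s` with nearby centre. Working
with the measure `withDensity` avoids any measurability assumption on `F`. -/
theorem isOpen_lt_lintegral_ball (μ : Measure E) (s : ℝ) (F : E → ℝ≥0∞) (c : ℝ≥0∞) :
    IsOpen {x : E | c < ∫⁻ y in ball x s, F y ∂μ} := by
  rw [Metric.isOpen_iff]
  intro x hx
  have hU : ball x s = ⋃ n : ℕ, ball x (s - 1 / ((n : ℝ) + 1)) := by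
    ext y
    simp only [mem_ball, mem_iUnion]
    constructor
    · intro h
      obtain ⟨n, hn⟩ := exists_nat_one_div_lt (sub_pos.2 h)
      exact ⟨n, by linarith⟩
    · rintro ⟨n, hn⟩
      have : (0 : ℝ) < 1 / ((n : ℝ) + 1) := by positivity
      linarith
  have hmono : Monotone fun n : ℕ => ball x (s - 1 / ((n : ℝ) + 1)) := by
    intro a b hab
    apply ball_subset_ball
    have := Nat.one_div_le_one_div (α := ℝ) hab
    linarith
  simp only [mem_ofPred_eq] at hx
  rw [hU, ← withDensity_apply _ (MeasurableSet.iUnion fun _ => measurableSet_ball),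
    hmono.measure_iUnion, lt_iSup_iff] at hx
  obtain ⟨n, hn⟩ := hx
  rw [withDensity_apply _ measurableSet_ball] at hn
  refine ⟨1 / ((n : ℝ) + 1), by positivity, fun y hy => hn.trans_le ?_⟩
  refine lintegral_mono_set (ball_subset_ball' ?_)
  rw [mem_ball'] at hy
  linarith

variable [NormedSpace ℝ E] [FiniteDimensional ℝ E] (μ : Measure E) [μ.IsAddHaarMeasure]

theorem isOpen_lt_maximalFunction (R : ℝ) (F : E → ℝ≥0∞) (c : ℝ≥0∞) :
    IsOpen {x : E | c < maximalFunction μ R F x} := by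
  have : {x : E | c < maximalFunction μ R F x} =
      ⋃ s ∈ Ioc (0 : ℝ) R, {x | c * μ (ball 0 s) < ∫⁻ y in ball x s, F y ∂μ} := by
    ext x
    simp only [maximalFunction, mem_ofPred_eq, lt_iSup_iff, mem_iUnion]
    refine exists_congr fun s => exists_congr fun hs => ?_
    rw [ENNReal.lt_div_iff_mul_lt (Or.inl (measure_ball_pos μ x hs.1).ne')
      (Or.inl measure_ball_lt_top.ne), addHaar_ball_center μ x]
  rw [this]
  exact isOpen_biUnion fun s _ => isOpen_lt_lintegral_ball μ s F _

theorem measurable_maximalFunction (R : ℝ) (F : E → ℝ≥0∞) :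
    Measurable (maximalFunction μ R F) :=
  measurable_of_Ioi fun c => (isOpen_lt_maximalFunction μ R F c).measurableSet

/-- The weak type `(1,1)` inequality. -/
theorem mul_measure_lt_maximalFunction_le (R : ℝ) (F : E → ℝ≥0∞) (c : ℝ≥0∞) :
    c * μ {x | c < maximalFunction μ R F x} ≤
      ENNReal.ofReal (5 ^ finrank ℝ E) * ∫⁻ x, F x ∂μ := by
  set S := {x | c < maximalFunction μ R F x} with hS
  have hsel : ∀ x ∈ S, ∃ s ∈ Ioc (0 : ℝ) R, c * μ (ball x s) < ∫⁻ y in ball x s, F y ∂μ := by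
    intro x hx
    simp only [hS, maximalFunction, mem_ofPred_eq, lt_iSup_iff] at hx
    obtain ⟨s, hs, h⟩ := hx
    exact ⟨s, hs, by rwa [ENNReal.lt_div_iff_mul_lt (Or.inl (measure_ball_pos μ x hs.1).ne')
      (Or.inl measure_ball_lt_top.ne)] at h⟩
  choose! s hs hsc using hsel
  -- The radii are bounded by `R`, as the Vitali covering lemma requires; the enlargement factor 5
  -- is the source of `5 ^ finrank ℝ E`.
  obtain ⟨u, huS, hdisj, hcov⟩ := Vitali.exists_disjoint_subfamily_covering_enlargement_closedBall
    S id s R (fun a ha => (hs a ha).2) 5 (by norm_num)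
  have hu : u.Countable := hdisj.countable_of_nonempty_interior fun a ha =>
    ⟨a, ball_subset_interior_closedBall (mem_ball_self (hs a (huS ha)).1)⟩
  have hsub : S ⊆ ⋃ b ∈ u, closedBall b (5 * s b) := by
    intro a ha
    obtain ⟨b, hb, hab⟩ := hcov a ha
    exact mem_biUnion hb (hab (mem_closedBall_self (hs a ha).1.le))
  calc c * μ S ≤ c * ∑' b : u, μ (closedBall (b : E) (5 * s b)) := by
        gcongr
        exact (measure_mono hsub).trans (measure_biUnion_le μ hu _)
    _ = ∑' b : u, c * μ (closedBall (b : E) (5 * s b)) := ENNReal.tsum_mul_left.symm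
    _ ≤ ∑' b : u, ENNReal.ofReal (5 ^ finrank ℝ E) * ∫⁻ y in closedBall (b : E) (s b), F y ∂μ := by
        refine ENNReal.tsum_le_tsum fun b => ?_
        have hb := huS b.2
        have h5 : μ (closedBall (b : E) (5 * s b)) =
            ENNReal.ofReal (5 ^ finrank ℝ E) * μ (ball (b : E) (s b)) := by
          have h0 := (hs b hb).1
          rw [addHaar_closedBall μ _ (by positivity), addHaar_ball_of_pos μ _ h0, mul_pow,
            ENNReal.ofReal_mul (by positivity), mul_assoc]
        rw [h5, mul_left_comm]
        gcongr
        exact (hsc b hb).le.trans (lintegral_mono_set ball_subset_closedBall)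
    _ = ENNReal.ofReal (5 ^ finrank ℝ E) * ∫⁻ y in ⋃ b ∈ u, closedBall b (s b), F y ∂μ := by
        rw [ENNReal.tsum_mul_left]
        congr 1
        exact (lintegral_biUnion hu (fun _ _ => measurableSet_closedBall) hdisj F).symm
    _ ≤ _ := mul_le_mul_right (setLIntegral_le_lintegral _ _) _

/-- The weak type inequality, restricted to the large values of the function. -/
theorem measure_lt_maximalFunction_le (R : ℝ) {F : E → ℝ≥0∞} (hF : Measurable F)
    {c : ℝ≥0∞} (hc : c ≠ 0) (hc' : c ≠ ⊤) :
    μ {x | c < maximalFunction μ R F x} ≤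
      2 * ENNReal.ofReal (5 ^ finrank ℝ E) / c * ∫⁻ x in {x | c / 2 < F x}, F x ∂μ := by
  have hmeas : MeasurableSet {x | c / 2 < F x} := measurableSet_lt measurable_const hF
  have hsub : {x | c < maximalFunction μ R F x} ⊆
      {x | c / 2 < maximalFunction μ R ({x | c / 2 < F x}.indicator F) x} := by
    intro x hx
    simp only [maximalFunction, mem_ofPred_eq, lt_iSup_iff] at hx ⊢
    obtain ⟨s, hs, h⟩ := hx
    refine ⟨s, hs, ?_⟩
    have h0 := (measure_ball_pos μ x hs.1).ne'
    have h1 : μ (ball x s) ≠ ⊤ := measure_ball_lt_top.ne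
    -- Values of `F` up to `c / 2` contribute at most `c / 2` to an average, so the large values
    -- must account for the other half.
    have hle : ∫⁻ y in ball x s, F y ∂μ ≤
        ∫⁻ y in ball x s, {x | c / 2 < F x}.indicator F y ∂μ + c / 2 * μ (ball x s) := by
      rw [← setLIntegral_const, ← lintegral_add_right _ measurable_const]
      refine lintegral_mono fun y => ?_
      by_cases hy : c / 2 < F y
      · simp [indicator, hy]
      · simpa [indicator, hy] using not_lt.1 hy
    by_contra! hcon
    refine absurd h (not_lt.2 ?_)
    calc (∫⁻ y in ball x s, F y ∂μ) / μ (ball x s)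
        ≤ (∫⁻ y in ball x s, {x | c / 2 < F x}.indicator F y ∂μ) / μ (ball x s) + c / 2 := by
          refine (ENNReal.div_le_div_right hle _).trans_eq ?_
          rw [ENNReal.add_div, ENNReal.mul_div_cancel_right h0 h1]
      _ ≤ c / 2 + c / 2 := by gcongr
      _ = c := ENNReal.add_halves c
  have hw := mul_measure_lt_maximalFunction_le μ R ({x | c / 2 < F x}.indicator F) (c / 2)
  rw [lintegral_indicator hmeas] at hw
  have h2 : c / 2 ≠ 0 := by simpa using hc
  have h3 : c / 2 ≠ ⊤ := ENNReal.div_ne_top hc' (by norm_num)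
  calc μ {x | c < maximalFunction μ R F x}
      ≤ (ENNReal.ofReal (5 ^ finrank ℝ E) * ∫⁻ x in {x | c / 2 < F x}, F x ∂μ) / (c / 2) := by
        rw [ENNReal.le_div_iff_mul_le (Or.inl h2) (Or.inl h3), mul_comm]
        exact le_trans (by gcongr) hw
    _ = _ := by
        generalize ∫⁻ x in {x | c / 2 < F x}, F x ∂μ = I
        rw [ENNReal.div_eq_inv_mul, ENNReal.inv_div (by norm_num) (by norm_num)]
        simp only [div_eq_mul_inv]
        ring

/-- The exponent is that of the layer-cake weight `t ^ (p - 1)` after the weak type bound has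
removed one power of `t`; it is integrable at the origin exactly because `p > 1`. -/
theorem lintegral_rpow_sub_two_Ioo {p : ℝ} (hp : 1 < p) {a : ℝ} (ha : 0 ≤ a) :
    ∫⁻ t in Ioo 0 a, ENNReal.ofReal (t ^ (p - 2)) = ENNReal.ofReal (a ^ (p - 1) / (p - 1)) := by
  have hint : IntervalIntegrable (fun t : ℝ => t ^ (p - 2)) volume 0 a :=
    intervalIntegral.intervalIntegrable_rpow' (by linarith)
  rw [restrict_congr_set Ioo_ae_eq_Ioc, ← ofReal_integral_eq_lintegral_ofReal,
    ← intervalIntegral.integral_of_le ha, integral_rpow (Or.inl (by linarith))]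
  · rw [show p - 2 + 1 = p - 1 by ring, Real.zero_rpow (by linarith), sub_zero]
  · rwa [intervalIntegrable_iff_integrableOn_Ioc_of_le ha] at hint
  · filter_upwards [ae_restrict_mem measurableSet_Ioc] with t ht
    exact Real.rpow_nonneg ht.1.le _

/-- The strong type `(p,p)` inequality. -/
theorem lintegral_maximalFunction_rpow_le (E : Type*) [NormedAddCommGroup E] [NormedSpace ℝ E]
    [FiniteDimensional ℝ E] [MeasurableSpace E] [BorelSpace E] {p : ℝ} (hp : 1 < p) :
    ∃ C : ℝ≥0, ∀ (μ : Measure E) [μ.IsAddHaarMeasure] (R : ℝ) (F : E → ℝ≥0∞), Measurable F →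
      ∫⁻ x, maximalFunction μ R F x ^ p ∂μ ≤ C * ∫⁻ x, F x ^ p ∂μ := by
  refine ⟨Real.toNNReal p * (2 * Real.toNNReal (5 ^ finrank ℝ E) *
    Real.toNNReal (2 ^ (p - 1) / (p - 1))), fun μ _ R F hF => ?_⟩
  have hp0 : 0 < p := by linarith
  set M := maximalFunction μ R F with hM
  have hMm : Measurable M := measurable_maximalFunction μ R F
  -- The layer-cake formula is for real-valued functions, so `M` is truncated at height `n`; the
  -- bound is uniform in `n` and monotone convergence concludes.
  have key : ∀ n : ℕ, ∫⁻ x, min (M x) n ^ p ∂μ ≤ ENNReal.ofReal p *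
      (2 * ENNReal.ofReal (5 ^ finrank ℝ E) *
      (ENNReal.ofReal (2 ^ (p - 1) / (p - 1)) * ∫⁻ x, F x ^ p ∂μ)) := by
    intro n
    have hfin : ∀ x, min (M x) n ≠ ⊤ := fun x =>
      ((min_le_right _ _).trans_lt (ENNReal.natCast_lt_top n)).ne
    have h1 : ∫⁻ x, min (M x) n ^ p ∂μ = ∫⁻ x, ENNReal.ofReal ((min (M x) n).toReal ^ p) ∂μ := by
      refine lintegral_congr fun x => ?_
      rw [← ENNReal.ofReal_rpow_of_nonneg ENNReal.toReal_nonneg hp0.le,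
        ENNReal.ofReal_toReal (hfin x)]
    rw [h1, lintegral_rpow_eq_lintegral_meas_lt_mul μ (Filter.Eventually.of_forall fun x =>
      ENNReal.toReal_nonneg) (hMm.min measurable_const).ennreal_toReal.aemeasurable hp0]
    gcongr
    calc ∫⁻ t in Ioi (0 : ℝ), μ {a | t < (min (M a) n).toReal} * ENNReal.ofReal (t ^ (p - 1))
        ≤ ∫⁻ t in Ioi (0 : ℝ), 2 * ENNReal.ofReal (5 ^ finrank ℝ E) *
            ∫⁻ x, {q : ℝ × E | ENNReal.ofReal q.1 / 2 < F q.2}.indicator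
              (fun q => F q.2 * ENNReal.ofReal (q.1 ^ (p - 2))) (t, x) ∂μ := by
          refine setLIntegral_mono' measurableSet_Ioi fun t ht => ?_
          have ht0 : 0 < t := ht
          have hsub : {a | t < (min (M a) n).toReal} ⊆ {a | ENNReal.ofReal t < M a} := by
            intro a ha
            exact ((ENNReal.ofReal_lt_iff_lt_toReal ht0.le (hfin a)).2 ha).trans_le (min_le_left _ _)
          have hw := measure_lt_maximalFunction_le μ R hF (c := ENNReal.ofReal t)
            (by simpa using ht0) ENNReal.ofReal_ne_top
          have hms : MeasurableSet {x | ENNReal.ofReal t / 2 < F x} :=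
            measurableSet_lt measurable_const hF
          have hR : ∫⁻ x, {q : ℝ × E | ENNReal.ofReal q.1 / 2 < F q.2}.indicator
              (fun q => F q.2 * ENNReal.ofReal (q.1 ^ (p - 2))) (t, x) ∂μ =
              (∫⁻ x in {x | ENNReal.ofReal t / 2 < F x}, F x ∂μ) * ENNReal.ofReal (t ^ (p - 2)) := by
            rw [← lintegral_mul_const _ hF, ← lintegral_indicator hms]
            rfl
          rw [hR]
          have hpow : ENNReal.ofReal (t ^ (p - 1)) =
              ENNReal.ofReal t * ENNReal.ofReal (t ^ (p - 2)) := by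
            rw [← ENNReal.ofReal_mul ht0.le]
            congr 1
            rw [show p - 1 = 1 + (p - 2) by ring, Real.rpow_add ht0, Real.rpow_one]
          calc μ {a | t < (min (M a) n).toReal} * ENNReal.ofReal (t ^ (p - 1))
              ≤ (2 * ENNReal.ofReal (5 ^ finrank ℝ E) / ENNReal.ofReal t *
                ∫⁻ x in {x | ENNReal.ofReal t / 2 < F x}, F x ∂μ) *
                (ENNReal.ofReal t * ENNReal.ofReal (t ^ (p - 2))) := by
                rw [hpow]
                gcongr
                exact (measure_mono hsub).trans hw
            _ = (2 * ENNReal.ofReal (5 ^ finrank ℝ E) / ENNReal.ofReal t * ENNReal.ofReal t) *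
                ((∫⁻ x in {x | ENNReal.ofReal t / 2 < F x}, F x ∂μ) *
                  ENNReal.ofReal (t ^ (p - 2))) := by ring
            _ = _ := by
                rw [ENNReal.div_mul_cancel (by simpa using ht0) ENNReal.ofReal_ne_top]
      _ = 2 * ENNReal.ofReal (5 ^ finrank ℝ E) * ∫⁻ x, (∫⁻ t in Ioi (0 : ℝ),
            {q : ℝ × E | ENNReal.ofReal q.1 / 2 < F q.2}.indicator
              (fun q => F q.2 * ENNReal.ofReal (q.1 ^ (p - 2))) (t, x)) ∂μ := by
          have hmeas : Measurable ({q : ℝ × E | ENNReal.ofReal q.1 / 2 < F q.2}.indicator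
              (fun q => F q.2 * ENNReal.ofReal (q.1 ^ (p - 2)))) := by
            refine Measurable.indicator (by fun_prop) (measurableSet_lt (by fun_prop) (by fun_prop))
          rw [lintegral_const_mul' _ _ (ENNReal.mul_ne_top (by norm_num) ENNReal.ofReal_ne_top),
            lintegral_lintegral_swap]
          exact hmeas.aemeasurable
      _ ≤ 2 * ENNReal.ofReal (5 ^ finrank ℝ E) * ∫⁻ x,
            ENNReal.ofReal (2 ^ (p - 1) / (p - 1)) * F x ^ p ∂μ := by
          gcongr with x
          by_cases hx : F x = ⊤
          · rw [hx, ENNReal.top_rpow_of_pos hp0, ENNReal.mul_top]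
            · exact le_top
            · have : (0 : ℝ) < 2 ^ (p - 1) / (p - 1) := div_pos (by positivity) (by linarith)
              simpa using this
          -- After Tonelli, for fixed `x` only the heights `t < 2 * F x` contribute.
          have hind : ∀ t ∈ Ioi (0 : ℝ), {q : ℝ × E | ENNReal.ofReal q.1 / 2 < F q.2}.indicator
              (fun q => F q.2 * ENNReal.ofReal (q.1 ^ (p - 2))) (t, x) =
              (Ioo 0 (2 * (F x).toReal)).indicator
                (fun t => F x * ENNReal.ofReal (t ^ (p - 2))) t := by
            intro t ht
            have ht0 : 0 < t := ht
            have : ENNReal.ofReal t / 2 < F x ↔ t < 2 * (F x).toReal := by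
              rw [ENNReal.div_lt_iff (by norm_num) (by norm_num),
                ENNReal.ofReal_lt_iff_lt_toReal ht0.le (ENNReal.mul_ne_top hx (by norm_num)),
                ENNReal.toReal_mul, mul_comm]
              norm_num
            simp only [indicator, mem_ofPred_eq, this, mem_Ioo, ht0, true_and]
          rw [setLIntegral_congr_fun measurableSet_Ioi hind,
            setLIntegral_indicator measurableSet_Ioo,
            inter_eq_left.2 (Ioo_subset_Ioi_self), lintegral_const_mul' _ _ hx,
            lintegral_rpow_sub_two_Ioo hp (by positivity)]
          nth_rw 1 [← ENNReal.ofReal_toReal hx]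
          rw [← ENNReal.ofReal_mul ENNReal.toReal_nonneg]
          nth_rw 3 [← ENNReal.ofReal_toReal hx]
          rw [ENNReal.ofReal_rpow_of_nonneg ENNReal.toReal_nonneg hp0.le,
            ← ENNReal.ofReal_mul (div_nonneg (by positivity) (by linarith))]
          refine ENNReal.ofReal_le_ofReal (le_of_eq ?_)
          rw [Real.mul_rpow (by norm_num) ENNReal.toReal_nonneg]
          have : (F x).toReal ^ p = (F x).toReal * (F x).toReal ^ (p - 1) := by
            rw [← Real.rpow_one_add' ENNReal.toReal_nonneg (by linarith)]
            congr 1; ring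
          rw [this]; ring
      _ = _ := by rw [lintegral_const_mul' _ _ ENNReal.ofReal_ne_top]
  have hsup : ∀ x, M x ^ p = ⨆ n : ℕ, min (M x) n ^ p := by
    intro x
    have : M x = ⨆ n : ℕ, min (M x) n := by
      have h := inf_iSup_eq (M x) (fun n : ℕ => (n : ℝ≥0∞))
      rw [ENNReal.iSup_natCast, inf_top_eq] at h
      exact h
    conv_lhs => rw [this]
    exact (ENNReal.orderIsoRpow p hp0).map_iSup _
  simp_rw [hsup]
  rw [lintegral_iSup]
  · refine (iSup_le key).trans_eq ?_
    push_cast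
    simp only [ENNReal.ofReal]
    ring
  · exact fun n => (hMm.min measurable_const).pow_const _
  · intro a b hab x
    dsimp only
    gcongr

end MaximalFunction

/-! ### Finite differences on the line. -/

section FiniteDifferences

/-- Finite differences of order `m + 1` are controlled by the derivative of order `m + 1`. -/
theorem exists_abs_fwdDiff_iter_le (m : ℕ) : ∃ C : ℝ, 0 ≤ C ∧ ∀ g : ℕ → ℝ → ℝ,
    (∀ j t, HasDerivAt (g j) (g (j + 1) t) t) → ∀ a : ℝ,
      |(fwdDiff (1 : ℝ))^[m + 1] (g 0) a| ≤ C * ∫ t in a..a + (m + 1 : ℕ), |g (m + 1) t| := by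
  induction m with
  | zero =>
    refine ⟨1, zero_le_one, fun g hg a => ?_⟩
    have hc : Continuous (g 1) := continuous_iff_continuousAt.2 fun t => (hg 1 t).continuousAt
    have h := intervalIntegral.integral_eq_sub_of_hasDerivAt (f := g 0) (f' := g 1) (a := a)
      (b := a + 1) (fun t _ => hg 0 t) (hc.intervalIntegrable _ _)
    simp only [zero_add, Function.iterate_one, fwdDiff, Nat.cast_one, one_mul]
    rw [← h]
    exact intervalIntegral.abs_integral_le_integral_abs (by linarith)
  | succ m ih =>
    obtain ⟨C, hC, ih⟩ := ih
    refine ⟨C * (m + 1 : ℕ), by positivity, fun g hg a => ?_⟩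
    have hc : ∀ j, Continuous (g j) := fun j =>
      continuous_iff_continuousAt.2 fun t => (hg j t).continuousAt
    -- The unit differences of a chain of derivatives again form such a chain, so induction applies
    -- to them.
    have h := ih (fun j t => g j (t + 1) - g j t)
      (fun j t => ((hg j (t + 1)).comp_add_const t 1).sub (hg j t)) a
    rw [Function.iterate_succ_apply]
    refine h.trans ?_
    rw [mul_assoc]
    gcongr
    set I := ∫ t in a..a + ((m + 1 + 1 : ℕ) : ℝ), |g (m + 1 + 1) t| with hI
    have hbound : ∀ t ∈ Icc a (a + ((m + 1 : ℕ) : ℝ)), |g (m + 1) (t + 1) - g (m + 1) t| ≤ I := by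
      intro t ht
      have h := intervalIntegral.integral_eq_sub_of_hasDerivAt (f := g (m + 1))
        (f' := g (m + 1 + 1)) (a := t) (b := t + 1) (fun t _ => hg _ t)
        ((hc _).intervalIntegrable _ _)
      rw [← h]
      refine (intervalIntegral.abs_integral_le_integral_abs (by linarith)).trans ?_
      refine intervalIntegral.integral_mono_interval ht.1 (by linarith) ?_ ?_ ?_
      · have := ht.2
        push_cast at this ⊢
        linarith
      · exact Filter.Eventually.of_forall fun t => abs_nonneg _
      · exact (hc _).abs.intervalIntegrable _ _
    have hle : a ≤ a + ((m + 1 : ℕ) : ℝ) := by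
      have : (0 : ℝ) ≤ ((m + 1 : ℕ) : ℝ) := by positivity
      linarith
    calc ∫ t in a..a + ((m + 1 : ℕ) : ℝ), |g (m + 1) (t + 1) - g (m + 1) t|
        ≤ ∫ _ in a..a + ((m + 1 : ℕ) : ℝ), I := by
          refine intervalIntegral.integral_mono_on hle ?_ (by simp) hbound
          exact (((hc _).comp (continuous_add_const 1)).sub (hc _)).abs.intervalIntegrable _ _
      _ = ((m + 1 : ℕ) : ℝ) * I := by simp

end FiniteDifferences

/-! ### Optimisation of the scale, for real numbers. -/

section Interpolation

/-- Optimisation of `t` in a family of bounds by `t ^ m * a + t ^ (-σ) * b`. -/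
theorem rpow_le_of_forall_le_add {m : ℕ} (hm : 0 < m) {p q σ : ℝ} (hp : 0 < p) (hpq : p < q)
    (hσm : σ * (q - p) ≤ p * m) {C a b d : ℝ} (hC : 0 ≤ C) (ha : 0 ≤ a) (hb : 0 ≤ b)
    (hd : 0 ≤ d) (h : ∀ t ∈ Ioo (0 : ℝ) 1, d ≤ C * (t ^ m * a + t ^ (-σ) * b)) :
    d ^ q ≤ ((2 * C) ^ q + (C * (1 + 2 ^ σ)) ^ (q - p)) * (b ^ (q - p) * (a ^ p + d ^ p)) := by
  have hq : 0 < q := hp.trans hpq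
  have hqp : 0 < q - p := sub_pos.2 hpq
  -- If `a ≤ b` the optimal scale may lie outside `(0, 1)`. The fixed choice `t = 1 / 2` then gives
  -- `d ≤ C' * b`, and `d ^ q = d ^ (q - p) * d ^ p` yields the term with `d ^ p`.
  rcases le_or_gt a b with hab | hab
  · have h1 : d ≤ C * (1 + 2 ^ σ) * b := by
      refine (h (1 / 2) ⟨by norm_num, by norm_num⟩).trans ?_
      rw [one_div, Real.inv_rpow (by norm_num), Real.rpow_neg (by norm_num), inv_inv, mul_assoc,
        add_mul, one_mul]
      gcongr
      calc (2⁻¹ : ℝ) ^ m * a ≤ 1 * a := by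
            gcongr
            exact pow_le_one₀ (by norm_num) (by norm_num)
        _ ≤ b := by rwa [one_mul]
    calc d ^ q = d ^ (q - p) * d ^ p := by
          rw [← Real.rpow_add' hd (by simpa using hq.ne'), sub_add_cancel]
      _ ≤ (C * (1 + 2 ^ σ) * b) ^ (q - p) * d ^ p := by gcongr
      _ = (C * (1 + 2 ^ σ)) ^ (q - p) * (b ^ (q - p) * d ^ p) := by
          rw [Real.mul_rpow (by positivity) hb, mul_assoc]
      _ ≤ _ := by
          gcongr
          · exact le_add_of_nonneg_left (by positivity)
          · exact le_add_of_nonneg_left (by positivity)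
  · have ha0 : 0 < a := hb.trans_lt hab
    rcases hb.eq_or_lt with rfl | hb0
    · have hd0 : d = 0 := by
        by_contra hne
        have hd0 : 0 < d := lt_of_le_of_ne hd (Ne.symm hne)
        -- With `b = 0` the bound tends to zero with `t`; this `t` is small enough to contradict `d
        -- > 0`.
        set t := min (1 / 2) (d / (2 * (C * a + 1))) with ht
        have hCa : 0 ≤ C * a := by positivity
        have ht0 : 0 < t := lt_min (by norm_num) (by positivity)
        have ht1 : t < 1 := (min_le_left _ _).trans_lt (by norm_num)
        have h1 := h t ⟨ht0, ht1⟩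
        have h2 : t ^ m ≤ t := pow_le_of_le_one ht0.le ht1.le hm.ne'
        have h3 : t * (2 * (C * a + 1)) ≤ d := by
          rw [← le_div_iff₀ (by positivity)]
          exact min_le_right _ _
        have h4 : C * (t ^ m * a) ≤ t * (C * a) := by
          calc C * (t ^ m * a) ≤ C * (t * a) := by gcongr
            _ = t * (C * a) := by ring
        rw [mul_zero, add_zero] at h1
        nlinarith
      rw [hd0, Real.zero_rpow hq.ne']
      positivity
    · set x := b / a with hx
      have hx0 : 0 < x := by positivity
      have hx1 : x < 1 := (div_lt_one ha0).2 hab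
      set θ := p / q with hθ
      have hθ1 : 0 < 1 - θ := by
        rw [hθ, sub_pos, div_lt_one hq]
        exact hpq
      have hm' : (0 : ℝ) < m := by exact_mod_cast hm
      -- This `t` makes `t ^ m * a` equal to `a ^ θ * b ^ (1 - θ)`, whose `q`-th power is `a ^ p * b
      -- ^ (q - p)`. Since `x < 1`, `hσm` says that the second term is no larger.
      have h1 := h (x ^ ((1 - θ) / m)) ⟨by positivity,
        Real.rpow_lt_one hx0.le hx1 (by positivity)⟩
      rw [← Real.rpow_natCast, ← Real.rpow_mul hx0.le, ← Real.rpow_mul hx0.le,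
        div_mul_cancel₀ _ hm'.ne'] at h1
      have h2 : x ^ ((1 - θ) / m * -σ) * b ≤ x ^ (1 - θ) * a := by
        calc x ^ ((1 - θ) / m * -σ) * b ≤ x ^ (-θ) * b := by
              have hexp : -θ ≤ (1 - θ) / m * -σ := by
                rw [mul_neg, neg_le_neg_iff, div_mul_eq_mul_div, div_le_iff₀ hm', hθ]
                rw [show (1 - p / q) * σ = σ * (q - p) / q by field_simp, div_mul_eq_mul_div]
                gcongr
              exact mul_le_mul_of_nonneg_right
                (Real.rpow_le_rpow_of_exponent_ge hx0 hx1.le hexp) hb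
          _ = x ^ (1 - θ) * a := by
              rw [show (1 - θ) = -θ + 1 by ring, Real.rpow_add hx0, Real.rpow_one, mul_assoc, hx,
                div_mul_cancel₀ _ ha0.ne']
      have h3 : d ≤ 2 * C * (x ^ (1 - θ) * a) := by
        refine h1.trans ?_
        rw [show 2 * C * (x ^ (1 - θ) * a) = C * (x ^ (1 - θ) * a + x ^ (1 - θ) * a) by ring]
        gcongr
      calc d ^ q ≤ (2 * C * (x ^ (1 - θ) * a)) ^ q := by gcongr
        _ = (2 * C) ^ q * (b ^ (q - p) * a ^ p) := by
            rw [Real.mul_rpow (x := 2 * C) (by positivity) (by positivity),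
              Real.mul_rpow (x := x ^ (1 - θ)) (by positivity) ha, ← Real.rpow_mul hx0.le,
              show (1 - θ) * q = q - p by rw [hθ]; field_simp, hx, Real.div_rpow hb ha]
            have : a ^ q = a ^ (q - p) * a ^ p := by
              rw [← Real.rpow_add ha0, sub_add_cancel]
            rw [this]
            field_simp
        _ ≤ _ := by
            gcongr
            · exact le_add_of_nonneg_right (by positivity)
            · exact le_add_of_nonneg_right (by positivity)

end Interpolation

/-! ### Weak derivatives, mollification and polynomials. -/

section WeakDerivatives

open Metric Module Function
open scoped Convolution

variable {N : ℕ}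

local notation "𝔼" => EuclideanSpace ℝ (Fin N)

/-- The convolution of a scalar kernel with a vector valued function. -/
noncomputable abbrev mollify {F : Type*} [NormedAddCommGroup F] [NormedSpace ℝ F] (φ : 𝔼 → ℝ)
    (g : 𝔼 → F) : 𝔼 → F :=
  φ ⋆[ContinuousLinearMap.lsmul ℝ ℝ, volume] g

/-- Derivatives of a function precomposed with the affine map `y ↦ c • (x - y)`. -/
theorem iteratedFDeriv_comp_smul_const_sub {χ : 𝔼 → ℝ} (hχ : ContDiff ℝ ∞ χ) (c : ℝ) (x y : 𝔼)
    (j : ℕ) :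
    iteratedFDeriv ℝ j (fun y => χ (c • (x - y))) y =
      (-c) ^ j • iteratedFDeriv ℝ j χ (c • (x - y)) := by
  have h : (fun y => χ (c • (x - y))) =
      fun y => (χ ∘ ((-c) • ContinuousLinearMap.id ℝ 𝔼)) (y - x) := by
    ext y
    simp only [comp_apply, _root_.smul_apply, ContinuousLinearMap.id_apply, neg_smul,
      ← smul_neg, neg_sub]
  rw [h, iteratedFDeriv_comp_sub, ContinuousLinearMap.iteratedFDeriv_comp_right _ hχ _
    (by exact_mod_cast le_top)]
  ext v
  simp only [ContinuousMultilinearMap.compContinuousLinearMap_apply,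
    _root_.smul_apply, ContinuousLinearMap.id_apply]
  rw [ContinuousMultilinearMap.map_smul_univ]
  simp only [Finset.prod_const, Finset.card_univ, Fintype.card_fin, neg_smul,
    ← smul_neg, neg_sub]

theorem contDiff_iteratedFDeriv_apply {ψ : 𝔼 → ℝ} (hψ : ContDiff ℝ ∞ ψ) (j : ℕ) (v : Fin j → 𝔼) :
    ContDiff ℝ ∞ fun x => iteratedFDeriv ℝ j ψ x v :=
  (ContinuousMultilinearMap.apply ℝ (fun _ : Fin j => 𝔼) ℝ v).contDiff.comp
    (hψ.iteratedFDeriv_right (by norm_cast))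

theorem hasCompactSupport_iteratedFDeriv_apply {ψ : 𝔼 → ℝ} (hψ : HasCompactSupport ψ) (j : ℕ)
    (v : Fin j → 𝔼) : HasCompactSupport fun x => iteratedFDeriv ℝ j ψ x v :=
  (hψ.iteratedFDeriv (𝕜 := ℝ) j).comp_left (g := fun A : 𝔼 [×j]→L[ℝ] ℝ => A v) rfl

theorem iteratedFDeriv_succ_apply_eq_fderiv {ψ : 𝔼 → ℝ} (hψ : ContDiff ℝ ∞ ψ) (ℓ : ℕ) (y : 𝔼)
    (v : Fin (ℓ + 1) → 𝔼) : iteratedFDeriv ℝ (ℓ + 1) ψ y v =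
      fderiv ℝ (fun y => iteratedFDeriv ℝ ℓ ψ y (Fin.tail v)) y (v 0) := by
  rw [iteratedFDeriv_succ_apply_left]
  have hd : DifferentiableAt ℝ (iteratedFDeriv ℝ ℓ ψ) y :=
    (hψ.differentiable_iteratedFDeriv (by exact_mod_cast WithTop.coe_lt_top _)).differentiableAt
  have := ((ContinuousMultilinearMap.apply ℝ (fun _ : Fin ℓ => 𝔼) ℝ
    (Fin.tail v)).hasFDerivAt.comp y hd.hasFDerivAt).fderiv
  exact (congrArg (fun L => L (v 0)) this).symm

theorem contDiff_comp_smul_const_sub {χ : 𝔼 → ℝ} (hχ : ContDiff ℝ ∞ χ) (c : ℝ) (x : 𝔼) :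
    ContDiff ℝ ∞ fun y => χ (c • (x - y)) :=
  hχ.comp (by fun_prop)

theorem hasCompactSupport_comp_smul_const_sub {χ : 𝔼 → ℝ} (hχ : HasCompactSupport χ) {c : ℝ}
    (hc : c ≠ 0) (x : 𝔼) : HasCompactSupport fun y => χ (c • (x - y)) :=
  hχ.comp_homeomorph ((Homeomorph.subLeft x).trans (Homeomorph.smulOfNeZero c hc))

namespace HasWeakDeriv

variable {j : ℕ} {u : EuclideanSpace ℝ (Fin N) → ℝ}
  {g : EuclideanSpace ℝ (Fin N) → (EuclideanSpace ℝ (Fin N)) [×j]→L[ℝ] ℝ}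

theorem ae_eq {g' : 𝔼 → 𝔼 [×j]→L[ℝ] ℝ} (h : HasWeakDeriv j u g)
    (h' : HasWeakDeriv j u g') : g =ᵐ[volume] g' := by
  refine ae_eq_of_integral_contDiff_smul_eq h.2.1 h'.2.1 fun φ hφ hφc => ?_
  have := (h.2.2 φ hφ hφc).symm.trans (h'.2.2 φ hφ hφc)
  exact smul_right_injective _ (pow_ne_zero j (by norm_num : (-1 : ℝ) ≠ 0)) this

theorem integral_apply (h : HasWeakDeriv j u g) {ψ : 𝔼 → ℝ} (hψ : ContDiff ℝ ∞ ψ)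
    (hψc : HasCompactSupport ψ) (v : Fin j → 𝔼) :
    (∫ x, ψ x • g x) v = (-1) ^ j * ∫ x, u x * iteratedFDeriv ℝ j ψ x v := by
  have h1 : Integrable (fun x => u x • iteratedFDeriv ℝ j ψ x) :=
    h.1.integrable_smul_right_of_hasCompactSupport
      (hψ.continuous_iteratedFDeriv (by exact_mod_cast le_top)) (hψc.iteratedFDeriv j)
  have h2 := ContinuousLinearMap.integral_comp_comm
    (ContinuousMultilinearMap.apply ℝ (fun _ : Fin j => 𝔼) ℝ v) h1
  simp only [ContinuousMultilinearMap.apply_apply, _root_.smul_apply,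
    smul_eq_mul] at h2
  rw [h2, h.2.2 ψ hψ hψc, _root_.smul_apply, smul_eq_mul, ← mul_assoc,
    ← mul_pow]
  norm_num

/-- Mollifying the weak derivative amounts to convolving with the derivative of the mollifier. -/
theorem convolution_apply (h : HasWeakDeriv j u g) {φ : 𝔼 → ℝ} (hφ : ContDiff ℝ ∞ φ)
    (hφc : HasCompactSupport φ) (x : 𝔼) (v : Fin j → 𝔼) :
    mollify φ g x v = mollify (fun z => iteratedFDeriv ℝ j φ z v) u x := by
  have h1 := h.integral_apply (contDiff_comp_smul_const_sub hφ 1 x)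
    (hasCompactSupport_comp_smul_const_sub hφc one_ne_zero x) v
  have hD : ∀ y, iteratedFDeriv ℝ j (fun y => φ (x - y)) y =
      (-1 : ℝ) ^ j • iteratedFDeriv ℝ j φ (x - y) := fun y => by
    simpa only [one_smul] using iteratedFDeriv_comp_smul_const_sub hφ 1 x y j
  simp only [one_smul, hD, _root_.smul_apply, smul_eq_mul] at h1
  rw [mollify, mollify, convolution_eq_swap, convolution_eq_swap]
  simp only [ContinuousLinearMap.lsmul_apply, smul_eq_mul]
  rw [h1, ← integral_const_mul]
  refine integral_congr_ae (Filter.Eventually.of_forall fun y => ?_)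
  dsimp only
  rw [show (-1 : ℝ) ^ j * (u y * ((-1) ^ j * iteratedFDeriv ℝ j φ (x - y) v)) =
    ((-1) * (-1)) ^ j * (iteratedFDeriv ℝ j φ (x - y) v * u y) by rw [mul_pow]; ring]
  norm_num

end HasWeakDeriv

section Polynomials

theorem MvPolynomial.hasFDerivAt_eval (P : MvPolynomial (Fin N) ℝ) (x : 𝔼) :
    HasFDerivAt (fun y : 𝔼 => MvPolynomial.eval (fun i => y i) P)
      (∑ i, MvPolynomial.eval (fun i => x i) (MvPolynomial.pderiv i P) •
        (EuclideanSpace.proj i : 𝔼 →L[ℝ] ℝ)) x := by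
  induction P using MvPolynomial.induction_on with
  | C a => simpa using hasFDerivAt_const a x
  | add p q hp hq =>
    have e : (fun y : 𝔼 => MvPolynomial.eval (fun i => y i) (p + q)) =
        fun y : 𝔼 => MvPolynomial.eval (fun i => y i) p + MvPolynomial.eval (fun i => y i) q := by
      ext y; simp
    rw [e]
    exact (hp.add hq).congr_fderiv (by simp [add_smul, Finset.sum_add_distrib])
  | mul_X p i hp =>
    have hi : HasFDerivAt (fun y : 𝔼 => y i) (EuclideanSpace.proj i : 𝔼 →L[ℝ] ℝ) x :=
      (EuclideanSpace.proj i : 𝔼 →L[ℝ] ℝ).hasFDerivAt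
    have e : (fun y : 𝔼 => MvPolynomial.eval (fun i => y i) (p * MvPolynomial.X i)) =
        fun y : 𝔼 => MvPolynomial.eval (fun i => y i) p * y i := by
      ext y; simp
    rw [e]
    refine (hp.mul hi).congr_fderiv ?_
    ext v
    simp only [Derivation.leibniz, MvPolynomial.pderiv_X, smul_eq_mul, map_add, map_mul,
      MvPolynomial.eval_X, add_smul, Finset.sum_add_distrib]
    simp [Pi.single_apply, Finset.mul_sum, mul_assoc]

theorem MvPolynomial.contDiff_eval (P : MvPolynomial (Fin N) ℝ) :
    ContDiff ℝ ∞ (fun y : 𝔼 => MvPolynomial.eval (fun i => y i) P) := by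
  induction P using MvPolynomial.induction_on with
  | C a => simpa using contDiff_const
  | add p q hp hq => simpa using hp.add hq
  | mul_X p i hp =>
    simpa using hp.mul (EuclideanSpace.proj i : 𝔼 →L[ℝ] ℝ).contDiff

theorem sum_smul_pderiv_mem_polysDegreeLT {ℓ : ℕ} {P : MvPolynomial (Fin N) ℝ}
    (hP : P ∈ polysDegreeLT N (ℓ + 1)) (v : Fin N → ℝ) :
    ∑ i, v i • MvPolynomial.pderiv i P ∈ polysDegreeLT N ℓ := by
  -- A condition on monomials treats the zero polynomial and the bound `n = 0` uniformly.
  have hmem : ∀ (n : ℕ) (Q : MvPolynomial (Fin N) ℝ), Q ∈ polysDegreeLT N n ↔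
      ∀ s ∈ Q.support, s.degree < n := by
    intro n Q
    constructor
    · rintro (rfl | h) s hs
      · simp at hs
      · exact (MvPolynomial.le_totalDegree hs).trans_lt h
    · intro h
      by_cases hQ : Q = 0
      · exact Or.inl hQ
      · refine Or.inr ?_
        obtain ⟨s, hs⟩ := MvPolynomial.support_nonempty.2 hQ
        rw [MvPolynomial.totalDegree, Finset.sup_lt_iff ((Nat.zero_le _).trans_lt (h s hs))]
        exact fun s hs => h s hs
  rw [hmem] at hP ⊢
  intro s hs
  rw [MvPolynomial.mem_support_iff, MvPolynomial.coeff_sum] at hs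
  obtain ⟨i, -, hi⟩ := Finset.exists_ne_zero_of_sum_ne_zero hs
  rw [MvPolynomial.coeff_smul, MvPolynomial.coeff_pderiv] at hi
  have h2 := hP (s + Finsupp.single i 1) (by
    rw [MvPolynomial.mem_support_iff]
    intro h0
    simp [h0] at hi)
  simpa using h2

/-- Each integration by parts moves one derivative onto the polynomial and lowers its degree bound;
after `ℓ` of them only the zero polynomial remains. -/
theorem integral_eval_mul_iteratedFDeriv_eq_zero {ℓ : ℕ} {P : MvPolynomial (Fin N) ℝ}
    (hP : P ∈ polysDegreeLT N ℓ) {ψ : 𝔼 → ℝ} (hψ : ContDiff ℝ ∞ ψ) (hψc : HasCompactSupport ψ)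
    (v : Fin ℓ → 𝔼) :
    ∫ y : 𝔼, MvPolynomial.eval (fun i => y i) P * iteratedFDeriv ℝ ℓ ψ y v = 0 := by
  induction ℓ generalizing P with
  | zero =>
    obtain rfl : P = 0 := by simpa [polysDegreeLT] using hP
    simp
  | succ ℓ ih =>
    have hD := fun y => iteratedFDeriv_succ_apply_eq_fderiv hψ ℓ y v
    have hs := contDiff_iteratedFDeriv_apply hψ ℓ (Fin.tail v)
    have hc := hasCompactSupport_iteratedFDeriv_apply hψc ℓ (Fin.tail v)
    have hPc := MvPolynomial.contDiff_eval P
    have hderiv : ∀ y : 𝔼, fderiv ℝ (fun y : 𝔼 => MvPolynomial.eval (fun i => y i) P) y (v 0) =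
        MvPolynomial.eval (fun i => y i) (∑ i, v 0 i • MvPolynomial.pderiv i P) := by
      intro y
      rw [(MvPolynomial.hasFDerivAt_eval P y).fderiv]
      simp [map_sum, MvPolynomial.smul_eval, mul_comm]
    simp_rw [hD]
    rw [integral_mul_fderiv_eq_neg_fderiv_mul_of_integrable]
    · simp_rw [hderiv]
      rw [ih (sum_smul_pderiv_mem_polysDegreeLT hP _) (Fin.tail v), neg_zero]
    · simp_rw [hderiv]
      exact ((MvPolynomial.contDiff_eval _).continuous.mul
        hs.continuous).integrable_of_hasCompactSupport hc.mul_left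
    · refine (hPc.continuous.mul ?_).integrable_of_hasCompactSupport
        ((hc.fderiv_apply (𝕜 := ℝ) (v 0)).mul_left)
      exact (hs.continuous_fderiv (by simp)).clm_apply continuous_const
    · exact (hPc.continuous.mul hs.continuous).integrable_of_hasCompactSupport hc.mul_left
    · exact fun x _ => (hPc.differentiable (by simp)).differentiableAt
    · exact fun x _ => (hs.differentiable (by simp)).differentiableAt

end Polynomials

end WeakDerivatives

/-! ### Averages of weak derivatives and the Campanato seminorm. -/

section CampanatoBound

open Metric Module Function
open scoped Convolution

variable {N : ℕ}

local notation "𝔼" => EuclideanSpace ℝ (Fin N)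

/-- Testing a weak derivative only sees the distance to polynomials. -/
theorem HasWeakDeriv.enorm_integral_smul_le {ℓ : ℕ} {u : 𝔼 → ℝ} {g : 𝔼 → 𝔼 [×ℓ]→L[ℝ] ℝ}
    (h : HasWeakDeriv ℓ u g) {ψ : 𝔼 → ℝ} (hψ : ContDiff ℝ ∞ ψ) (hψc : HasCompactSupport ψ)
    {A : ℝ} (hA0 : 0 ≤ A) (hA : ∀ y, ‖iteratedFDeriv ℝ ℓ ψ y‖ ≤ A) {s : Set 𝔼}
    (hs : tsupport ψ ⊆ s) {P : MvPolynomial (Fin N) ℝ} (hP : P ∈ polysDegreeLT N ℓ) :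
    ‖∫ y, ψ y • g y‖ₑ ≤
      ENNReal.ofReal A * ∫⁻ y in s, ‖u y - MvPolynomial.eval (fun i => y i) P‖ₑ := by
  by_cases htop : ENNReal.ofReal A *
      ∫⁻ y in s, ‖u y - MvPolynomial.eval (fun i => y i) P‖ₑ = ⊤
  · rw [htop]; exact le_top
  rw [← ofReal_norm, ENNReal.ofReal_le_iff_le_toReal htop]
  -- Evaluating at `v` reduces to scalar test functions, for which `P` can be subtracted from `u` at
  -- no cost.
  refine ContinuousMultilinearMap.opNorm_le_bound ENNReal.toReal_nonneg fun v => ?_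
  have hu : Integrable (fun y => u y * iteratedFDeriv ℝ ℓ ψ y v) :=
    h.1.integrable_smul_right_of_hasCompactSupport (contDiff_iteratedFDeriv_apply hψ ℓ v).continuous
      (hasCompactSupport_iteratedFDeriv_apply hψc ℓ v)
  have hPi : Integrable (fun y : 𝔼 => MvPolynomial.eval (fun i => y i) P *
      iteratedFDeriv ℝ ℓ ψ y v) :=
    ((MvPolynomial.contDiff_eval P).continuous.mul
      (contDiff_iteratedFDeriv_apply hψ ℓ v).continuous).integrable_of_hasCompactSupport
      (hasCompactSupport_iteratedFDeriv_apply hψc ℓ v).mul_left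
  have heq : ∫ y, u y * iteratedFDeriv ℝ ℓ ψ y v =
      ∫ y : 𝔼, (u y - MvPolynomial.eval (fun i => y i) P) * iteratedFDeriv ℝ ℓ ψ y v := by
    simp_rw [sub_mul]
    rw [integral_sub hu hPi, integral_eval_mul_iteratedFDeriv_eq_zero hP hψ hψc, sub_zero]
  rw [h.integral_apply hψ hψc, norm_mul, norm_pow, norm_neg, norm_one, one_pow, one_mul, heq,
    ← toReal_enorm, ← ENNReal.toReal_ofReal (Finset.prod_nonneg fun i _ => norm_nonneg (v i)),
    ← ENNReal.toReal_mul]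
  refine ENNReal.toReal_mono (ENNReal.mul_ne_top htop ENNReal.ofReal_ne_top) ?_
  refine (enorm_integral_le_lintegral_enorm _).trans ?_
  have hzero : ∀ y ∉ s, ‖(u y - MvPolynomial.eval (fun i => y i) P) *
      iteratedFDeriv ℝ ℓ ψ y v‖ₑ = 0 := by
    intro y hy
    have : iteratedFDeriv ℝ ℓ ψ y = 0 := by
      by_contra hne
      exact hy (hs (support_iteratedFDeriv_subset (𝕜 := ℝ) ℓ hne))
    simp [this]
  rw [← setLIntegral_eq_of_support_subset (s := s) (fun y hy => by
    by_contra hys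
    exact hy (hzero y hys)), mul_right_comm, mul_comm,
    ← lintegral_mul_const' _ _ (ENNReal.mul_ne_top ENNReal.ofReal_ne_top ENNReal.ofReal_ne_top)]
  refine lintegral_mono fun y => ?_
  rw [enorm_mul, ← ENNReal.ofReal_mul hA0]
  gcongr
  rw [← ofReal_norm]
  refine ENNReal.ofReal_le_ofReal ((ContinuousMultilinearMap.le_opNorm _ v).trans ?_)
  gcongr
  exact hA y

/-- The `L¹`-normalised rescaling of a kernel. -/
noncomputable def rescale (χ : 𝔼 → ℝ) (s : ℝ) (y : 𝔼) : ℝ :=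
  (s ^ N)⁻¹ * χ (s⁻¹ • y)

theorem contDiff_rescale {χ : 𝔼 → ℝ} (hχ : ContDiff ℝ ∞ χ) (s : ℝ) :
    ContDiff ℝ ∞ (rescale χ s) :=
  contDiff_const.mul (hχ.comp (contDiff_const_smul _))

theorem hasCompactSupport_rescale {χ : 𝔼 → ℝ} (hχ : HasCompactSupport χ) {s : ℝ} (hs : s ≠ 0) :
    HasCompactSupport (rescale χ s) :=
  HasCompactSupport.mul_left (hχ.comp_homeomorph (Homeomorph.smulOfNeZero s⁻¹ (inv_ne_zero hs)))

/-- Mollified weak derivatives at scale `s` are controlled by the Campanato seminorm. -/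
theorem exists_enorm_mollify_rescale_le {χ : 𝔼 → ℝ} (hχ : ContDiff ℝ ∞ χ)
    (hχc : tsupport χ ⊆ ball 0 1) (ℓ : ℕ) : ∃ C : ℝ≥0, ∀ (lam ρ : ℝ) (u : 𝔼 → ℝ)
    (g : 𝔼 → 𝔼 [×ℓ]→L[ℝ] ℝ), HasWeakDeriv ℓ u g → ∀ s ∈ Ioo 0 ρ, ∀ x,
      ‖mollify (rescale χ s) g x‖ₑ ≤
        C * ENNReal.ofReal (s ^ (-(ℓ + lam))) * campanatoSeminorm lam ℓ ρ u := by
  have hcs : HasCompactSupport χ := HasCompactSupport.of_support_subset_isCompact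
    (isCompact_closedBall 0 1) ((subset_tsupport χ).trans (hχc.trans ball_subset_closedBall))
  obtain ⟨A, hA⟩ := (hcs.iteratedFDeriv (𝕜 := ℝ) ℓ).exists_bound_of_continuous
    (hχ.continuous_iteratedFDeriv (m := ℓ) (by exact_mod_cast le_top))
  have hA0 : 0 ≤ A := (norm_nonneg _).trans (hA 0)
  -- `A` bounds the derivative of `χ`; the volume of the unit ball comes from replacing `s ^ (-N)`
  -- times an integral over the ball of radius `s` by an average.
  refine ⟨Real.toNNReal A * (volume (ball (0 : 𝔼) 1)).toNNReal, fun lam ρ u g h s hs x => ?_⟩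
  have hs0 : 0 < s := hs.1
  have hmol : mollify (rescale χ s) g x = ∫ y, ((s ^ N)⁻¹ * χ (s⁻¹ • (x - y))) • g y := by
    rw [mollify, convolution_eq_swap]
    rfl
  have hψ : ContDiff ℝ ∞ fun y => (s ^ N)⁻¹ * χ (s⁻¹ • (x - y)) :=
    contDiff_const.mul (contDiff_comp_smul_const_sub hχ _ x)
  have hψc : HasCompactSupport fun y => (s ^ N)⁻¹ * χ (s⁻¹ • (x - y)) :=
    (hasCompactSupport_comp_smul_const_sub hcs (inv_ne_zero hs0.ne') x).mul_left
  have hD : ∀ y, ‖iteratedFDeriv ℝ ℓ (fun y => (s ^ N)⁻¹ * χ (s⁻¹ • (x - y))) y‖ ≤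
      (s ^ N)⁻¹ * ((s ^ ℓ)⁻¹ * A) := by
    intro y
    have h1 : iteratedFDeriv ℝ ℓ (fun y => (s ^ N)⁻¹ * χ (s⁻¹ • (x - y))) y =
        (s ^ N)⁻¹ • iteratedFDeriv ℝ ℓ (fun y => χ (s⁻¹ • (x - y))) y :=
      iteratedFDeriv_const_smul_apply' (a := (s ^ N)⁻¹)
        ((contDiff_comp_smul_const_sub hχ s⁻¹ x).of_le (by exact_mod_cast le_top)).contDiffAt
    rw [h1, iteratedFDeriv_comp_smul_const_sub hχ, norm_smul, norm_smul, Real.norm_of_nonneg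
      (by positivity), norm_pow, norm_neg, norm_inv, Real.norm_of_nonneg hs0.le, inv_pow]
    gcongr
    exact hA _
  have hts : tsupport (fun y => (s ^ N)⁻¹ * χ (s⁻¹ • (x - y))) ⊆ ball x s := by
    have h1 : tsupport (fun y => (s ^ N)⁻¹ * χ (s⁻¹ • (x - y))) ⊆
        (fun y => s⁻¹ • (x - y)) ⁻¹' tsupport χ := by
      refine closure_minimal (fun y hy => subset_tsupport χ ?_)
        ((isClosed_tsupport χ).preimage (by fun_prop))
      exact right_ne_zero_of_mul hy
    refine h1.trans fun y hy => ?_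
    have := hχc hy
    rw [mem_ball_zero_iff, norm_smul, norm_inv, Real.norm_of_nonneg hs0.le, inv_mul_lt_iff₀ hs0,
      mul_one] at this
    rwa [mem_ball, dist_comm, dist_eq_norm]
  have hvol : volume (ball x s) = ENNReal.ofReal (s ^ N) * volume (ball (0 : 𝔼) 1) := by
    rw [Measure.addHaar_ball_of_pos _ _ hs0, finrank_euclideanSpace_fin]
  have hκ0 : volume (ball (0 : 𝔼) 1) ≠ 0 := (measure_ball_pos _ _ one_pos).ne'
  have hκt : volume (ball (0 : 𝔼) 1) ≠ ⊤ := measure_ball_lt_top.ne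
  have hv0 : volume (ball x s) ≠ 0 := (measure_ball_pos _ _ hs0).ne'
  have hvt : volume (ball x s) ≠ ⊤ := measure_ball_lt_top.ne
  have hB : ENNReal.ofReal (s ^ lam) * ⨅ P ∈ polysDegreeLT N ℓ,
      ⨍⁻ y in ball x s, ‖u y - MvPolynomial.eval (fun i => y i) P‖ₑ ∂volume ≤
      campanatoSeminorm lam ℓ ρ u :=
    le_iSup_of_le x (le_iSup₂_of_le s hs le_rfl)
  have hinf : ‖mollify (rescale χ s) g x‖ₑ ≤
      (ENNReal.ofReal A * volume (ball (0 : 𝔼) 1) * ENNReal.ofReal ((s ^ ℓ)⁻¹)) *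
      ⨅ P ∈ polysDegreeLT N ℓ,
        ⨍⁻ y in ball x s, ‖u y - MvPolynomial.eval (fun i => y i) P‖ₑ ∂volume := by
    have hne : ENNReal.ofReal A * volume (ball (0 : 𝔼) 1) * ENNReal.ofReal ((s ^ ℓ)⁻¹) ≠ ⊤ :=
      ENNReal.mul_ne_top (ENNReal.mul_ne_top ENNReal.ofReal_ne_top hκt) ENNReal.ofReal_ne_top
    rw [iInf_subtype', ENNReal.mul_iInf' (fun h => absurd h hne) (fun _ => ⟨⟨0, Or.inl rfl⟩⟩)]
    refine le_iInf fun P => ?_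
    refine (hmol ▸ h.enorm_integral_smul_le hψ hψc (by positivity) hD hts P.2).trans_eq ?_
    rw [setLAverage_eq, ENNReal.ofReal_mul (by positivity), ENNReal.ofReal_mul (by positivity),
      hvol, ENNReal.ofReal_inv_of_pos (by positivity), div_eq_mul_inv,
      ENNReal.mul_inv (Or.inr hκt) (Or.inr hκ0)]
    generalize ∫⁻ y in ball x s, ‖u y - MvPolynomial.eval (fun i => y i) (P : MvPolynomial _ ℝ)‖ₑ = I
    calc _ = (ENNReal.ofReal (s ^ N))⁻¹ * (ENNReal.ofReal (s ^ ℓ)⁻¹ * ENNReal.ofReal A) * I *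
          (volume (ball (0 : 𝔼) 1) * (volume (ball (0 : 𝔼) 1))⁻¹) := by
          rw [ENNReal.mul_inv_cancel hκ0 hκt, mul_one]
      _ = _ := by ring
  refine hinf.trans ?_
  calc _ = (ENNReal.ofReal A * volume (ball (0 : 𝔼) 1) * ENNReal.ofReal (s ^ (-(ℓ + lam)))) *
        (ENNReal.ofReal (s ^ lam) * ⨅ P ∈ polysDegreeLT N ℓ,
        ⨍⁻ y in ball x s, ‖u y - MvPolynomial.eval (fun i => y i) P‖ₑ ∂volume) := by
        have : (s ^ ℓ)⁻¹ = s ^ (-(ℓ + lam)) * s ^ lam := by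
          rw [← Real.rpow_add hs0, ← Real.rpow_natCast, ← Real.rpow_neg hs0.le]
          congr 1; ring
        rw [this, ENNReal.ofReal_mul (by positivity)]
        ring
    _ ≤ _ := by
        push_cast
        rw [ENNReal.coe_toNNReal hκt]
        exact mul_le_mul_right hB _

end CampanatoBound

/-! ### Mollified derivatives and their finite differences. -/

section Mollification

open Metric Module Function
open scoped Convolution

variable {N : ℕ}

local notation "𝔼" => EuclideanSpace ℝ (Fin N)

variable {F : Type*} [NormedAddCommGroup F] [NormedSpace ℝ F]

theorem continuous_mollify {φ : 𝔼 → ℝ} (hφ : Continuous φ) (hφc : HasCompactSupport φ) {g : 𝔼 → F}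
    (hg : LocallyIntegrable g) : Continuous (mollify φ g) :=
  hφc.continuous_convolution_left _ hφ hg

/-- Associativity reduces this to commutativity for scalar kernels. It lets an averaging kernel act
on the weak derivative itself, where the Campanato bound is available, before the smoothing. -/
theorem mollify_comm [CompleteSpace F] {φ ψ : 𝔼 → ℝ} (hφ : Continuous φ) (hφc : HasCompactSupport φ)
    (hψ : Continuous ψ) (hψc : HasCompactSupport ψ) {g : 𝔼 → F} (hg : LocallyIntegrable g) :
    mollify φ (mollify ψ g) = mollify ψ (mollify φ g) := by
  have key : ∀ {φ ψ : 𝔼 → ℝ}, Continuous φ → HasCompactSupport φ → Continuous ψ →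
      HasCompactSupport ψ → ∀ x, mollify (mollify φ ψ) g x = mollify φ (mollify ψ g) x := by
    intro φ ψ hφ hφc hψ hψc x
    have hgn : LocallyIntegrable (fun x => ‖g x‖) := fun x =>
      let ⟨s, hs, hi⟩ := hg x
      ⟨s, hs, hi.norm⟩
    refine convolution_assoc (ContinuousLinearMap.lsmul ℝ ℝ) (ContinuousLinearMap.lsmul ℝ ℝ)
      (ContinuousLinearMap.lsmul ℝ ℝ) (ContinuousLinearMap.lsmul ℝ ℝ) (fun a b c => by
        simpa [mul_smul] using smul_comm a b c) hφ.aestronglyMeasurable hψ.aestronglyMeasurable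
        hg.aestronglyMeasurable ?_ ?_ ?_
    · exact Filter.Eventually.of_forall
        (hφc.convolutionExists_left _ hφ (hψ.locallyIntegrable))
    · exact Filter.Eventually.of_forall
        (hψc.norm.convolutionExists_left _ hψ.norm hgn)
    · exact hφc.norm.convolutionExists_left _ hφ.norm
        (hψc.norm.continuous_convolution_left _ hψ.norm hgn).locallyIntegrable x
  ext x
  rw [← key hφ hφc hψ hψc, ← key hψ hψc hφ hφc]
  have : mollify φ ψ = mollify ψ φ := by
    ext y
    rw [mollify, mollify, convolution_lsmul, convolution_lsmul_swap]
    simp only [smul_eq_mul, mul_comm]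
  rw [this]

theorem enorm_mollify_le {φ : 𝔼 → ℝ} (hφ0 : ∀ x, 0 ≤ φ x) (hφi : Integrable φ)
    (hφ1 : ∫ x, φ x = 1) {g : 𝔼 → F} {K : ℝ≥0∞} (hg : ∀ x, ‖g x‖ₑ ≤ K) (x : 𝔼) :
    ‖mollify φ g x‖ₑ ≤ K := by
  refine (enorm_integral_le_lintegral_enorm _).trans ?_
  calc ∫⁻ t, ‖φ t • g (x - t)‖ₑ ≤ ∫⁻ t, ‖φ t‖ₑ * K := by
        refine lintegral_mono fun t => ?_
        rw [enorm_smul]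
        gcongr
        exact hg _
    _ = K := by
        rw [lintegral_mul_const'' _ hφi.aestronglyMeasurable.enorm, ← ofReal_integral_norm_eq_lintegral_enorm hφi]
        simp_rw [Real.norm_of_nonneg (hφ0 _), hφ1, ENNReal.ofReal_one, one_mul]

theorem hasDerivAt_mollify_line {K : 𝔼 → ℝ} (hK : ContDiff ℝ ∞ K) (hKc : HasCompactSupport K)
    {u : 𝔼 → ℝ} (hu : LocallyIntegrable u) (x h : 𝔼) (t : ℝ) :
    HasDerivAt (fun t : ℝ => mollify K u (x + t • h))
      (mollify (fun z => fderiv ℝ K z h) u (x + t • h)) t := by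
  have h1 := hKc.hasFDerivAt_convolution_right (ContinuousLinearMap.lsmul ℝ ℝ : ℝ →L[ℝ] ℝ →L[ℝ] ℝ)
    hu (hK.of_le (by exact_mod_cast le_top)) (x + t • h)
  have h2 : HasDerivAt (fun t : ℝ => x + t • h) h t := by
    simpa using ((hasDerivAt_id t).smul_const h).const_add x
  have h3 := h1.comp_hasDerivAt t h2
  rw [convolution_precompR_apply _ hu (hKc.fderiv (𝕜 := ℝ)) (hK.continuous_fderiv (by simp))] at h3
  have hc : ∀ (K : 𝔼 → ℝ) y, (u ⋆[ContinuousLinearMap.lsmul ℝ ℝ, volume] K) y = mollify K u y := by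
    intro K y
    rw [mollify, convolution_lsmul, convolution_lsmul_swap]
    simp only [smul_eq_mul, mul_comm]
  rw [hc] at h3
  refine h3.congr_of_eventuallyEq (Filter.Eventually.of_forall fun t => ?_)
  exact (hc K _).symm

/-- The vectors `v` preceded by `j` copies of `h`. -/
def prependConst (h : 𝔼) {ℓ : ℕ} (v : Fin ℓ → 𝔼) : (j : ℕ) → Fin (ℓ + j) → 𝔼
  | 0 => v
  | j + 1 => Fin.cons h (prependConst h v j)

theorem prod_norm_prependConst (h : 𝔼) {ℓ : ℕ} (v : Fin ℓ → 𝔼) (j : ℕ) :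
    ∏ i, ‖prependConst h v j i‖ = ‖h‖ ^ j * ∏ i, ‖v i‖ := by
  induction j with
  | zero => simp [prependConst]
  | succ j ih =>
    change ∏ i : Fin (ℓ + j + 1), ‖(Fin.cons h (prependConst h v j) : Fin (ℓ + j + 1) → 𝔼) i‖ = _
    rw [Fin.prod_univ_succ]
    simp only [Fin.cons_zero, Fin.cons_succ, ih, pow_succ']
    ring

/-- Finite differences of the mollified derivative of order `ℓ` along a direction are controlled by
the mollified derivative of higher order. -/
theorem exists_abs_fwdDiff_iter_mollify_le (m : ℕ) : ∃ C : ℝ, 0 ≤ C ∧ ∀ (ℓ : ℕ)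
    (u : 𝔼 → ℝ) (g : 𝔼 → 𝔼 [×ℓ]→L[ℝ] ℝ) (G : 𝔼 → 𝔼 [×(ℓ + (m + 1))]→L[ℝ] ℝ),
    HasWeakDeriv ℓ u g → HasWeakDeriv (ℓ + (m + 1)) u G →
    ∀ φ : 𝔼 → ℝ, ContDiff ℝ ∞ φ → HasCompactSupport φ → ∀ (x h : 𝔼) (v : Fin ℓ → 𝔼),
      |(fwdDiff (1 : ℝ))^[m + 1] (fun t => mollify φ g (x + t • h) v) 0| ≤
        C * ‖h‖ ^ (m + 1) * (∫ t in (0 : ℝ)..(m + 1 : ℕ), ‖mollify φ G (x + t • h)‖) *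
          ∏ i, ‖v i‖ := by
  obtain ⟨C, hC, hdiff⟩ := exists_abs_fwdDiff_iter_le m
  refine ⟨C, hC, fun ℓ u g G hg hG φ hφ hφc x h v => ?_⟩
  -- Convolving `u` with the kernels `K j` gives, along the line `x + t • h`, a chain of successive
  -- `t`-derivatives starting from `mollify φ g` evaluated at `v`.
  set K : ℕ → 𝔼 → ℝ := fun j z => iteratedFDeriv ℝ (ℓ + j) φ z (prependConst h v j) with hK
  have hKs : ∀ j, ContDiff ℝ ∞ (K j) := fun j => contDiff_iteratedFDeriv_apply hφ _ _
  have hKc : ∀ j, HasCompactSupport (K j) := fun j =>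
    hasCompactSupport_iteratedFDeriv_apply hφc _ _
  have hKd : ∀ j, K (j + 1) = fun z => fderiv ℝ (K j) z h := by
    intro j
    ext z
    exact iteratedFDeriv_succ_apply_eq_fderiv hφ (ℓ + j) z (Fin.cons h (prependConst h v j))
  have hmain := hdiff (fun j t => mollify (K j) u (x + t • h)) (fun j t => by
    rw [hKd j]
    exact hasDerivAt_mollify_line (hKs j) (hKc j) hg.1 x h t) 0
  have h0 : (fun t : ℝ => mollify φ g (x + t • h) v) =
      fun t : ℝ => mollify (K 0) u (x + t • h) := by
    ext t
    exact hg.convolution_apply hφ hφc _ _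
  have hGc := continuous_mollify hφ.continuous hφc hG.2.1
  have hl : Continuous fun t : ℝ => x + t • h := by fun_prop
  rw [h0]
  refine hmain.trans ?_
  rw [mul_assoc, mul_assoc]
  refine mul_le_mul_of_nonneg_left ?_ hC
  rw [zero_add, mul_left_comm, ← prod_norm_prependConst,
    ← intervalIntegral.integral_mul_const]
  refine intervalIntegral.integral_mono_on (by positivity) ?_ ?_ fun t _ => ?_
  · exact ((continuous_mollify (hKs _).continuous (hKc _) hg.1).comp hl).abs.intervalIntegrable _ _
  · exact ((hGc.comp hl).norm.mul continuous_const).intervalIntegrable _ _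
  · rw [← hG.convolution_apply hφ hφc, ← Real.norm_eq_abs]
    exact ContinuousMultilinearMap.le_opNorm _ _

end Mollification

/-! ### The pointwise bound at a fixed scale. -/

section PointwiseBound

open Metric Module Function
open scoped Convolution

variable {N : ℕ}

local notation "𝔼" => EuclideanSpace ℝ (Fin N)

theorem lintegral_ball_comp_sub_smul {F : 𝔼 → ℝ≥0∞} (hF : Measurable F) (x : 𝔼) {s : ℝ}
    (hs : 0 < s) : ∫⁻ z in ball (0 : 𝔼) 1, F (x - s • z) =
      volume (ball (0 : 𝔼) 1) * ((∫⁻ y in ball x s, F y) / volume (ball x s)) := by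
  have hH : Measurable ((ball x s).indicator F) := hF.indicator measurableSet_ball
  have h1 : ∫⁻ z in ball (0 : 𝔼) 1, F (x - s • z) =
      ∫⁻ z, (ball x s).indicator F (x - s • z) := by
    rw [← lintegral_indicator measurableSet_ball]
    refine lintegral_congr fun z => ?_
    have : z ∈ ball (0 : 𝔼) 1 ↔ x - s • z ∈ ball x s := by
      rw [mem_ball_zero_iff, mem_ball, dist_eq_norm, sub_sub_cancel_left, norm_neg, norm_smul,
        Real.norm_of_nonneg hs.le, mul_lt_iff_lt_one_right hs]
    by_cases hz : z ∈ ball (0 : 𝔼) 1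
    · rw [indicator_of_mem hz, indicator_of_mem (this.1 hz)]
    · rw [indicator_of_notMem hz, indicator_of_notMem (fun h => hz (this.2 h))]
  have h2 : ∫⁻ z, (ball x s).indicator F (x - s • z) =
      ENNReal.ofReal ((s ^ N)⁻¹) * ∫⁻ y in ball x s, F y := by
    have hHx : Measurable fun y => (ball x s).indicator F (x - y) :=
      hH.comp (measurable_const.sub measurable_id)
    have h3 := lintegral_map (μ := volume) hHx (measurable_const_smul s : Measurable (s • · : 𝔼 → 𝔼))
    rw [Measure.map_addHaar_smul _ hs.ne', lintegral_smul_measure, lintegral_sub_left_eq_self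
      ((ball x s).indicator F) x, lintegral_indicator measurableSet_ball,
      finrank_euclideanSpace_fin, abs_of_pos (by positivity)] at h3
    rw [← h3, smul_eq_mul]
  have hκ0 : volume (ball (0 : 𝔼) 1) ≠ 0 := (measure_ball_pos _ _ one_pos).ne'
  have hκt : volume (ball (0 : 𝔼) 1) ≠ ⊤ := measure_ball_lt_top.ne
  rw [h1, h2, Measure.addHaar_ball_of_pos _ _ hs, finrank_euclideanSpace_fin,
    ENNReal.ofReal_inv_of_pos (by positivity), div_eq_mul_inv,
    ENNReal.mul_inv (Or.inr hκt) (Or.inr hκ0)]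
  generalize ∫⁻ y in ball x s, F y = I
  calc _ = (ENNReal.ofReal (s ^ N))⁻¹ * I *
        (volume (ball (0 : 𝔼) 1) * (volume (ball (0 : 𝔼) 1))⁻¹) := by
        rw [ENNReal.mul_inv_cancel hκ0 hκt, mul_one]
    _ = _ := by ring

theorem integral_smul_comp_sub_smul {F : Type*} [NormedAddCommGroup F] [NormedSpace ℝ F]
    (χ : 𝔼 → ℝ) (f : 𝔼 → F) (x : 𝔼) {s : ℝ} (hs : 0 < s) :
    ∫ z, χ z • f (x - s • z) = mollify (rescale χ s) f x := by
  have h := Measure.integral_comp_inv_smul_of_nonneg (μ := (volume : Measure 𝔼))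
    (fun z => χ z • f (x - s • z)) hs.le
  simp only [smul_inv_smul₀ hs.ne', finrank_euclideanSpace_fin] at h
  rw [mollify, convolution_lsmul]
  simp only [rescale, mul_smul]
  rw [integral_smul, h, inv_smul_smul₀ (by positivity)]

/-- The coefficients of the finite difference of order `n`. -/
def diffCoeff (n i : ℕ) : ℝ := (-1) ^ (n - i) * n.choose i

theorem exists_enorm_sum_diffCoeff_le (m : ℕ) : ∃ C : ℝ≥0, ∀ (ℓ : ℕ)
    (u : 𝔼 → ℝ) (g : 𝔼 → 𝔼 [×ℓ]→L[ℝ] ℝ) (G : 𝔼 → 𝔼 [×(ℓ + (m + 1))]→L[ℝ] ℝ),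
    HasWeakDeriv ℓ u g → HasWeakDeriv (ℓ + (m + 1)) u G →
    ∀ φ : 𝔼 → ℝ, ContDiff ℝ ∞ φ → HasCompactSupport φ → ∀ x h : 𝔼,
      ‖∑ i ∈ Finset.range (m + 1 + 1), diffCoeff (m + 1) i • mollify φ g (x + (i : ℝ) • h)‖ₑ ≤
        C * ‖h‖ₑ ^ (m + 1) *
          ∫⁻ t in Ioc (0 : ℝ) (m + 1 : ℕ), ‖mollify φ G (x + t • h)‖ₑ := by
  obtain ⟨C, hC, hdiff⟩ := exists_abs_fwdDiff_iter_mollify_le (N := N) m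
  refine ⟨C.toNNReal, fun ℓ u g G hg hG φ hφ hφc x h => ?_⟩
  have hGc : Continuous fun t : ℝ => mollify φ G (x + t • h) :=
    (continuous_mollify hφ.continuous hφc hG.2.1).comp (by fun_prop)
  set I := ∫ t in (0 : ℝ)..(m + 1 : ℕ), ‖mollify φ G (x + t • h)‖ with hI
  have hI0 : 0 ≤ I := intervalIntegral.integral_nonneg (by positivity) fun _ _ => norm_nonneg _
  have hIe : ENNReal.ofReal I =
      ∫⁻ t in Ioc (0 : ℝ) (m + 1 : ℕ), ‖mollify φ G (x + t • h)‖ₑ := by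
    rw [hI, intervalIntegral.integral_of_le (by positivity),
      ofReal_integral_norm_eq_lintegral_enorm]
    exact (intervalIntegrable_iff_integrableOn_Ioc_of_le (by positivity)).1
      (hGc.intervalIntegrable _ _)
  have hbound : ‖∑ i ∈ Finset.range (m + 1 + 1),
      diffCoeff (m + 1) i • mollify φ g (x + (i : ℝ) • h)‖ ≤ C * ‖h‖ ^ (m + 1) * I := by
    refine ContinuousMultilinearMap.opNorm_le_bound (by positivity) fun v => ?_
    have h1 := hdiff ℓ u g G hg hG φ hφ hφc x h v
    rw [fwdDiff_iter_eq_sum_shift] at h1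
    rw [Real.norm_eq_abs]
    convert h1 using 2
    rw [sum_apply]
    refine Finset.sum_congr rfl fun i _ => ?_
    simp [diffCoeff]
  rw [← hIe, ← ofReal_norm, ← ofReal_norm, ← ENNReal.ofReal_pow (norm_nonneg _)]
  change _ ≤ ENNReal.ofReal C * _ * _
  rw [← ENNReal.ofReal_mul hC, ← ENNReal.ofReal_mul (by positivity)]
  exact ENNReal.ofReal_le_ofReal hbound

/-- Averages of finite differences are controlled by the maximal function. -/
theorem lintegral_ball_differences_le {F : 𝔼 → ℝ≥0∞} (hF : Measurable F) (x : 𝔼) {r R : ℝ}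
    (hr : 0 < r) (n : ℕ) (hR : n * r ≤ R) :
    ∫⁻ z in ball (0 : 𝔼) 1, ∫⁻ t in Ioc (0 : ℝ) n, F (x + t • (-(r • z))) ≤
      volume (ball (0 : 𝔼) 1) * n * maximalFunction volume R F x := by
  -- For fixed `t` the points `x - (t * r) • z` fill a ball about `x` of radius `t * r ≤ n * r ≤ R`,
  -- so the inner integral is an average seen by the maximal function.
  rw [lintegral_lintegral_swap]
  · calc ∫⁻ t in Ioc (0 : ℝ) n, ∫⁻ z in ball (0 : 𝔼) 1, F (x + t • (-(r • z)))
        ≤ ∫⁻ _ in Ioc (0 : ℝ) n, volume (ball (0 : 𝔼) 1) * maximalFunction volume R F x := by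
          refine setLIntegral_mono' measurableSet_Ioc fun t ht => ?_
          have : ∀ z : 𝔼, x + t • (-(r • z)) = x - (t * r) • z := fun z => by
            rw [smul_neg, smul_smul, sub_eq_add_neg]
          simp_rw [this]
          have ht0 : 0 < t * r := mul_pos ht.1 hr
          rw [lintegral_ball_comp_sub_smul hF x ht0]
          gcongr
          exact le_iSup₂_of_le (t * r) ⟨ht0, (mul_le_mul_of_nonneg_right ht.2 hr.le).trans hR⟩ le_rfl
      _ = _ := by
          rw [setLIntegral_const, Real.volume_Ioc, sub_zero, ENNReal.ofReal_natCast]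
          ring
  · exact (hF.comp (by fun_prop)).aemeasurable

/-- A function is recovered from averages of its finite differences and averages of itself. -/
theorem enorm_le_lintegral_differences_add {V : Type*} [NormedAddCommGroup V] [NormedSpace ℝ V]
    [CompleteSpace V] {χ : 𝔼 → ℝ} (hχ : Continuous χ) (hχc : HasCompactSupport χ)
    (hχ1 : ∫ x, χ x = 1) {f : 𝔼 → V} (hf : Continuous f) (n : ℕ) (r : ℝ) (x : 𝔼) :
    ‖f x‖ₑ ≤ (∫⁻ z, ‖χ z‖ₑ *
        ‖∑ i ∈ Finset.range (n + 1), diffCoeff n i • f (x + (i : ℝ) • (-(r • z)))‖ₑ) +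
      ∑ i ∈ Finset.range n, ‖diffCoeff n (i + 1)‖ₑ *
        ‖∫ z, χ z • f (x - (((i + 1 : ℕ) : ℝ) * r) • z)‖ₑ := by
  set S : 𝔼 → V := fun z =>
    ∑ i ∈ Finset.range (n + 1), diffCoeff n i • f (x + (i : ℝ) • (-(r • z))) with hS
  have hint : ∀ i : ℕ, Integrable fun z => χ z • f (x - (i * r) • z) := fun i =>
    (hχ.smul (hf.comp (by fun_prop))).integrable_of_hasCompactSupport hχc.smul_right
  -- The zeroth term does not depend on `z`, and `χ` has integral one.
  have hsum : ∫ z, χ z • S z = diffCoeff n 0 • f x +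
      ∑ i ∈ Finset.range n, diffCoeff n (i + 1) • ∫ z, χ z • f (x - (((i + 1 : ℕ) : ℝ) * r) • z) := by
    have h1 : ∀ z, χ z • S z = ∑ i ∈ Finset.range (n + 1),
        diffCoeff n i • (χ z • f (x - (i * r) • z)) := by
      intro z
      rw [hS, Finset.smul_sum]
      refine Finset.sum_congr rfl fun i _ => ?_
      rw [smul_comm, smul_neg, smul_smul (i : ℝ), ← sub_eq_add_neg]
    simp_rw [h1]
    rw [integral_finsetSum _ fun i _ => (hint i).fun_smul (diffCoeff n i), Finset.sum_range_succ']
    simp_rw [integral_smul]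
    rw [add_comm]
    congr 1
    simp only [Nat.cast_zero, zero_mul, zero_smul, sub_zero]
    rw [integral_smul_const, hχ1, one_smul]
  have hc0 : ‖diffCoeff n 0‖ₑ = 1 := by
    rw [← ofReal_norm]
    simp [diffCoeff]
  calc ‖f x‖ₑ = ‖diffCoeff n 0 • f x‖ₑ := by rw [enorm_smul, hc0, one_mul]
    _ = ‖(∫ z, χ z • S z) - ∑ i ∈ Finset.range n, diffCoeff n (i + 1) •
        ∫ z, χ z • f (x - (((i + 1 : ℕ) : ℝ) * r) • z)‖ₑ := by rw [hsum, add_sub_cancel_right]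
    _ ≤ ‖∫ z, χ z • S z‖ₑ + ‖∑ i ∈ Finset.range n, diffCoeff n (i + 1) •
        ∫ z, χ z • f (x - (((i + 1 : ℕ) : ℝ) * r) • z)‖ₑ := enorm_sub_le
    _ ≤ _ := by
        gcongr
        · refine (enorm_integral_le_lintegral_enorm _).trans_eq ?_
          simp_rw [enorm_smul]
          rfl
        · refine (enorm_sum_le _ _).trans_eq ?_
          simp_rw [enorm_smul]

/-- The heart of the proof: the averaged difference gives the maximal function term and the
remaining averages give the Campanato term. The constant depends on neither `φ` nor `ρ`. -/
theorem exists_enorm_mollify_le_maximalFunction (N ℓ m : ℕ) (lam : ℝ) (hlam : -(ℓ : ℝ) ≤ lam) :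
    ∃ C : ℝ≥0, ∀ (ρ : ℝ) (u : EuclideanSpace ℝ (Fin N) → ℝ)
      (g : EuclideanSpace ℝ (Fin N) → (EuclideanSpace ℝ (Fin N)) [×ℓ]→L[ℝ] ℝ)
      (G : EuclideanSpace ℝ (Fin N) → (EuclideanSpace ℝ (Fin N)) [×(ℓ + (m + 1))]→L[ℝ] ℝ),
      HasWeakDeriv ℓ u g → HasWeakDeriv (ℓ + (m + 1)) u G →
      ∀ φ : EuclideanSpace ℝ (Fin N) → ℝ, ContDiff ℝ ∞ φ → HasCompactSupport φ → (∀ x, 0 ≤ φ x) →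
      ∫ x, φ x = 1 → ∀ x, ∀ t ∈ Ioo 0 ρ,
      ‖mollify φ g x‖ₑ ≤
        C * (ENNReal.ofReal (t ^ (m + 1)) *
            maximalFunction volume ρ (fun y => ‖mollify φ G y‖ₑ) x +
          ENNReal.ofReal (t ^ (-(ℓ + lam))) * campanatoSeminorm lam ℓ ρ u) := by
  let b : ContDiffBump (0 : EuclideanSpace ℝ (Fin N)) := ⟨1 / 4, 1 / 2, by norm_num, by norm_num⟩
  set χ := b.normed volume with hχdef
  have hχ : ContDiff ℝ ∞ χ := b.contDiff_normed
  have hχc : HasCompactSupport χ := b.hasCompactSupport_normed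
  have hχt : tsupport χ ⊆ ball 0 1 := by
    rw [hχdef, b.tsupport_normed_eq]
    exact closedBall_subset_ball (by norm_num [b])
  have hχ1 : ∫ x, χ x = 1 := b.integral_normed
  obtain ⟨A, hA⟩ := hχc.exists_bound_of_continuous hχ.continuous
  obtain ⟨C₁, hC₁⟩ := exists_enorm_sum_diffCoeff_le (N := N) m
  obtain ⟨C₂, hC₂⟩ := exists_enorm_mollify_rescale_le hχ hχt ℓ
  set n : ℕ := m + 1 with hn
  have hn0 : (0 : ℝ) < n := by positivity
  set D₁ : ℝ≥0 := A.toNNReal * C₁ * (volume (ball (0 : EuclideanSpace ℝ (Fin N)) 1)).toNNReal * n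
  set D₂ : ℝ≥0 := ∑ i ∈ Finset.range n, ‖diffCoeff n (i + 1)‖₊ *
    (C₂ * ((n : ℝ) ^ (ℓ + lam)).toNNReal)
  refine ⟨D₁ + D₂, fun ρ u g G hg hG φ hφ hφc hφ0 hφ1 x t ht => ?_⟩
  have ht0 : 0 < t := ht.1
  set f := mollify φ g with hf
  set F : EuclideanSpace ℝ (Fin N) → ℝ≥0∞ := fun y => ‖mollify φ G y‖ₑ with hFdef
  have hfc : Continuous f := continuous_mollify hφ.continuous hφc hg.2.1
  have hFm : Measurable F := (continuous_mollify hφ.continuous hφc hG.2.1).enorm.measurable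
  -- With this step every scale `i * r`, `1 ≤ i ≤ n`, lies between `t / n` and `t < ρ`.
  set r := t / n with hr
  have hr0 : 0 < r := by positivity
  have hnr : n * r = t := by rw [hr]; field_simp
  set M := maximalFunction volume ρ F x
  set B := campanatoSeminorm lam ℓ ρ u
  set S : EuclideanSpace ℝ (Fin N) → (EuclideanSpace ℝ (Fin N)) [×ℓ]→L[ℝ] ℝ := fun z =>
    ∑ i ∈ Finset.range (n + 1), diffCoeff n i • f (x + (i : ℝ) • (-(r • z))) with hS
  have hS1 : ∫⁻ z, ‖χ z‖ₑ * ‖S z‖ₑ ≤ D₁ * (ENNReal.ofReal (t ^ n) * M) := by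
    have hpt : ∀ z, ‖χ z‖ₑ * ‖S z‖ₑ ≤ (ball (0 : EuclideanSpace ℝ (Fin N)) 1).indicator (fun z =>
        ENNReal.ofReal A * (C₁ * ENNReal.ofReal (t ^ n)) *
          ∫⁻ t in Ioc (0 : ℝ) n, F (x + t • (-(r • z)))) z := by
      intro z
      by_cases hz : z ∈ ball (0 : EuclideanSpace ℝ (Fin N)) 1
      · rw [indicator_of_mem hz, mul_assoc]
        gcongr
        · rw [← ofReal_norm]
          exact ENNReal.ofReal_le_ofReal (hA z)
        · refine (hC₁ ℓ u g G hg hG φ hφ hφc x (-(r • z))).trans ?_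
          gcongr
          rw [← ofReal_norm, ← ENNReal.ofReal_pow (norm_nonneg _)]
          refine ENNReal.ofReal_le_ofReal ?_
          gcongr
          rw [norm_neg, norm_smul, Real.norm_of_nonneg hr0.le]
          rw [mem_ball_zero_iff] at hz
          calc r * ‖z‖ ≤ r * 1 := by gcongr
            _ ≤ n * r := by
              rw [mul_one]
              exact le_mul_of_one_le_left hr0.le (by exact_mod_cast Nat.succ_pos m)
            _ = t := hnr
      · rw [indicator_of_notMem hz]
        have : χ z = 0 := by
          by_contra hne
          exact hz (hχt (subset_tsupport χ hne))
        simp [this]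
    have hκt : volume (ball (0 : EuclideanSpace ℝ (Fin N)) 1) ≠ ⊤ := measure_ball_lt_top.ne
    calc ∫⁻ z, ‖χ z‖ₑ * ‖S z‖ₑ ≤ _ := lintegral_mono hpt
      _ = ENNReal.ofReal A * (C₁ * ENNReal.ofReal (t ^ n)) *
          ∫⁻ z in ball (0 : EuclideanSpace ℝ (Fin N)) 1,
            ∫⁻ t in Ioc (0 : ℝ) n, F (x + t • (-(r • z))) := by
          rw [lintegral_indicator measurableSet_ball, lintegral_const_mul' _ _ (by finiteness)]
      _ ≤ ENNReal.ofReal A * (C₁ * ENNReal.ofReal (t ^ n)) *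
          (volume (ball (0 : EuclideanSpace ℝ (Fin N)) 1) * n * M) := by
          gcongr
          exact lintegral_ball_differences_le hFm x hr0 n (hnr.le.trans ht.2.le)
      _ = _ := by
          simp only [D₁]
          push_cast
          rw [ENNReal.coe_toNNReal hκt]
          simp only [ENNReal.ofReal]
          ring
  have hS2 : ∀ i ∈ Finset.range n, ‖∫ z, χ z • f (x - (((i + 1 : ℕ) : ℝ) * r) • z)‖ₑ ≤
      (C₂ * ((n : ℝ) ^ (ℓ + lam)).toNNReal : ℝ≥0) * (ENNReal.ofReal (t ^ (-(ℓ + lam))) * B) := by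
    intro i hi
    have hi' : ((i + 1 : ℕ) : ℝ) ≤ n := by exact_mod_cast Finset.mem_range.1 hi
    have hi1 : (1 : ℝ) ≤ ((i + 1 : ℕ) : ℝ) := by exact_mod_cast Nat.succ_pos i
    set s := ((i + 1 : ℕ) : ℝ) * r with hs
    have hrs : r ≤ s := le_mul_of_one_le_left hr0.le hi1
    have hs0 : 0 < s := hr0.trans_le hrs
    have hst : s ≤ t := (mul_le_mul_of_nonneg_right hi' hr0.le).trans hnr.le
    -- Commuting the kernels puts the average at scale `s` on `g`, where it is bounded uniformly by
    -- the seminorm; smoothing with `φ` preserves that bound.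
    rw [integral_smul_comp_sub_smul χ f x hs0, hf,
      mollify_comm (contDiff_rescale hχ s).continuous (hasCompactSupport_rescale hχc hs0.ne')
        hφ.continuous hφc hg.2.1]
    refine enorm_mollify_le hφ0 (hφ.continuous.integrable_of_hasCompactSupport hφc) hφ1
      (fun y => (hC₂ lam ρ u g hg s ⟨hs0, hst.trans_lt ht.2⟩ y).trans ?_) x
    -- Here `-ℓ ≤ lam` is used: the power is nonincreasing, so the smallest scale `r` is the worst.
    have hpow : s ^ (-(ℓ + lam)) ≤ (n : ℝ) ^ (ℓ + lam) * t ^ (-(ℓ + lam)) := by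
      calc s ^ (-(ℓ + lam)) ≤ r ^ (-(ℓ + lam)) :=
            Real.rpow_le_rpow_of_nonpos hr0 hrs (by linarith)
        _ = (n : ℝ) ^ (ℓ + lam) * t ^ (-(ℓ + lam)) := by
            rw [hr, Real.div_rpow ht0.le hn0.le, Real.rpow_neg hn0.le, div_inv_eq_mul, mul_comm]
    calc _ ≤ (C₂ : ℝ≥0∞) * ENNReal.ofReal ((n : ℝ) ^ (ℓ + lam) * t ^ (-(ℓ + lam))) * B := by
          gcongr
      _ = _ := by
          rw [ENNReal.ofReal_mul (by positivity)]
          push_cast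
          simp only [ENNReal.ofReal]
          ring
  calc ‖f x‖ₑ ≤ _ := enorm_le_lintegral_differences_add hχ.continuous hχc hχ1 hfc n r x
    _ ≤ D₁ * (ENNReal.ofReal (t ^ n) * M) + D₂ * (ENNReal.ofReal (t ^ (-(ℓ + lam))) * B) := by
        refine add_le_add hS1 ?_
        simp only [D₂]
        push_cast
        rw [Finset.sum_mul]
        refine Finset.sum_le_sum fun i hi => ?_
        rw [mul_assoc]
        gcongr
        · exact le_rfl
        · exact_mod_cast hS2 i hi
    _ ≤ _ := by
        push_cast
        rw [mul_add]
        gcongr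
        · exact le_self_add
        · exact le_add_self

end PointwiseBound

/-! ### Integration of the pointwise bound. -/

section Interpolation

open Metric Module Function Filter
open scoped Convolution Topology

variable {N : ℕ}

local notation "𝔼" => EuclideanSpace ℝ (Fin N)

/-- Jensen's inequality for convolutions with probability densities. -/
theorem lintegral_enorm_mollify_rpow_le {F : Type*} [NormedAddCommGroup F] [NormedSpace ℝ F]
    {φ : 𝔼 → ℝ} (hφ : Continuous φ) (hφ0 : ∀ x, 0 ≤ φ x) (hφi : Integrable φ)
    (hφ1 : ∫ x, φ x = 1) {g : 𝔼 → F} (hg : AEStronglyMeasurable g) {p : ℝ} (hp : 1 ≤ p) :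
    ∫⁻ x, ‖mollify φ g x‖ₑ ^ p ≤ ∫⁻ x, ‖g x‖ₑ ^ p := by
  have hp0 : 0 < p := one_pos.trans_le hp
  have hw : Measurable fun t => ENNReal.ofReal (φ t) := hφ.measurable.ennreal_ofReal
  have hmass : ∫⁻ t, ENNReal.ofReal (φ t) = 1 := by
    rw [← ofReal_integral_eq_lintegral_ofReal hφi (Eventually.of_forall hφ0), hφ1,
      ENNReal.ofReal_one]
  set ν := volume.withDensity fun t => ENNReal.ofReal (φ t) with hν
  have : IsProbabilityMeasure ν := ⟨by rw [hν, withDensity_apply _ MeasurableSet.univ,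
    Measure.restrict_univ, hmass]⟩
  have hgx : ∀ x, AEStronglyMeasurable (fun t => g (x - t)) volume := fun x =>
    hg.comp_quasiMeasurePreserving (quasiMeasurePreserving_sub_left volume x)
  have hpt : ∀ x, ‖mollify φ g x‖ₑ ^ p ≤ ∫⁻ t, ENNReal.ofReal (φ t) * ‖g (x - t)‖ₑ ^ p := by
    intro x
    have h1 : ‖mollify φ g x‖ₑ ≤ ∫⁻ t, ‖g (x - t)‖ₑ ∂ν := by
      rw [hν, lintegral_withDensity_eq_lintegral_mul₀ hw.aemeasurable (hgx x).enorm]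
      refine (enorm_integral_le_lintegral_enorm _).trans_eq (lintegral_congr fun t => ?_)
      simp only [ContinuousLinearMap.lsmul_apply, enorm_smul, Pi.mul_apply]
      rw [← ofReal_norm (φ t), Real.norm_of_nonneg (hφ0 t)]
    -- Jensen's inequality in the form of monotonicity of `L^p` norms for the probability measure
    -- `ν`.
    have h2 := eLpNorm'_le_eLpNorm'_of_exponent_le one_pos hp ν
      ((hgx x).mono_ac (withDensity_absolutelyContinuous _ _))
    simp only [eLpNorm'_eq_lintegral_enorm, ENNReal.rpow_one, div_one] at h2
    calc ‖mollify φ g x‖ₑ ^ p ≤ ((∫⁻ t, ‖g (x - t)‖ₑ ^ p ∂ν) ^ (1 / p)) ^ p := by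
          gcongr
          exact h1.trans h2
      _ = ∫⁻ t, ‖g (x - t)‖ₑ ^ p ∂ν := by
          rw [← ENNReal.rpow_mul, one_div_mul_cancel hp0.ne', ENNReal.rpow_one]
      _ = _ := by
          rw [hν, lintegral_withDensity_eq_lintegral_mul₀ hw.aemeasurable
            ((hgx x).enorm.pow_const p)]
          rfl
  refine (lintegral_mono hpt).trans ?_
  rw [lintegral_lintegral_swap]
  · calc ∫⁻ t, ∫⁻ x, ENNReal.ofReal (φ t) * ‖g (x - t)‖ₑ ^ p
        = ∫⁻ t, ENNReal.ofReal (φ t) * ∫⁻ x, ‖g x‖ₑ ^ p := by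
          refine lintegral_congr fun t => ?_
          rw [lintegral_const_mul' _ _ ENNReal.ofReal_ne_top,
            lintegral_sub_right_eq_self (fun x => ‖g x‖ₑ ^ p) t]
      _ ≤ _ := by rw [lintegral_mul_const _ hw, hmass, one_mul]
  · refine (hw.comp measurable_snd).aemeasurable.mul (AEMeasurable.pow_const ?_ p)
    exact (hg.comp_quasiMeasurePreserving (quasiMeasurePreserving_sub volume volume)).enorm

/-- The interpolation inequality for mollified derivatives. -/
theorem exists_lintegral_mollify_rpow_le (N ℓ m : ℕ) {p q lam : ℝ} (hp : 1 < p) (hpq : p < q)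
    (hlam₁ : -(ℓ : ℝ) ≤ lam) (hlam₂ : (ℓ + lam) * (q - p) ≤ p * (m + 1 : ℕ)) :
    ∃ C : ℝ≥0, ∀ (ρ : ℝ), 0 < ρ → ∀ (u : EuclideanSpace ℝ (Fin N) → ℝ)
      (g : EuclideanSpace ℝ (Fin N) → (EuclideanSpace ℝ (Fin N)) [×ℓ]→L[ℝ] ℝ)
      (G : EuclideanSpace ℝ (Fin N) → (EuclideanSpace ℝ (Fin N)) [×(ℓ + (m + 1))]→L[ℝ] ℝ),
      HasWeakDeriv ℓ u g → HasWeakDeriv (ℓ + (m + 1)) u G → campanatoSeminorm lam ℓ ρ u < ⊤ →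
      ∫⁻ x, ‖G x‖ₑ ^ p < ⊤ →
      ∀ φ : EuclideanSpace ℝ (Fin N) → ℝ, ContDiff ℝ ∞ φ → HasCompactSupport φ → (∀ x, 0 ≤ φ x) →
      ∫ x, φ x = 1 →
      ∫⁻ x, ENNReal.ofReal (ρ ^ ((ℓ : ℝ) * q)) * ‖mollify φ g x‖ₑ ^ q ≤
        C * (ENNReal.ofReal (ρ ^ (-lam)) * campanatoSeminorm lam ℓ ρ u) ^ (q - p) *
          ∫⁻ x, (ENNReal.ofReal (ρ ^ (((ℓ + (m + 1) : ℕ) : ℝ) * p)) * ‖G x‖ₑ ^ p +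
            ENNReal.ofReal (ρ ^ ((ℓ : ℝ) * p)) * ‖g x‖ₑ ^ p) := by
  obtain ⟨C₁, hC₁⟩ := exists_enorm_mollify_le_maximalFunction N ℓ m lam hlam₁
  obtain ⟨C₂, hC₂⟩ := lintegral_maximalFunction_rpow_le (EuclideanSpace ℝ (Fin N)) hp
  have hp0 : 0 < p := one_pos.trans hp
  have hq0 : 0 < q := hp0.trans hpq
  have hqp : 0 < q - p := sub_pos.2 hpq
  set σ : ℝ := ℓ + lam with hσ
  have hσ0 : 0 ≤ σ := by linarith
  set K : ℝ≥0 := (2 * C₁) ^ q + (C₁ * (1 + 2 ^ σ)) ^ (q - p) with hK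
  refine ⟨K * (C₂ + 1), fun ρ hρ u g G hg hG hB hGp φ hφ hφc hφ0 hφ1 => ?_⟩
  set B := campanatoSeminorm lam ℓ ρ u
  set F : EuclideanSpace ℝ (Fin N) → ℝ≥0∞ := fun y => ‖mollify φ G y‖ₑ with hF
  have hFm : Measurable F := (continuous_mollify hφ.continuous hφc hG.2.1).enorm.measurable
  have hφi : Integrable φ := hφ.continuous.integrable_of_hasCompactSupport hφc
  set M := maximalFunction volume ρ F with hM
  have hMm : Measurable M := measurable_maximalFunction volume ρ F
  have hMp : ∫⁻ x, M x ^ p ≤ C₂ * ∫⁻ x, ‖G x‖ₑ ^ p := by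
    refine (hC₂ volume ρ F hFm).trans (mul_le_mul_right ?_ _)
    exact lintegral_enorm_mollify_rpow_le hφ.continuous hφ0 hφi hφ1 hG.2.1.aestronglyMeasurable hp.le
  have hMfin : ∀ᵐ x, M x < ⊤ := by
    have h1 := ae_lt_top (hMm.pow_const p) (hMp.trans_lt (ENNReal.mul_lt_top (by simp) hGp)).ne
    filter_upwards [h1] with x hx
    exact (ENNReal.rpow_lt_top_iff_of_pos hp0).1 hx
  set b := (ENNReal.ofReal (ρ ^ (-lam)) * B) ^ (q - p) with hb
  have hpt : ∀ᵐ x, ENNReal.ofReal (ρ ^ ((ℓ : ℝ) * q)) * ‖mollify φ g x‖ₑ ^ q ≤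
      K * b * (ENNReal.ofReal (ρ ^ (((ℓ + (m + 1) : ℕ) : ℝ) * p)) * M x ^ p +
        ENNReal.ofReal (ρ ^ ((ℓ : ℝ) * p)) * ‖mollify φ g x‖ₑ ^ p) := by
    filter_upwards [hMfin] with x hx
    -- The scale is `t * ρ` with `t` in `(0, 1)`; the powers of `ρ` are absorbed into `a`, `b` and
    -- `d`, so the optimisation constant does not depend on `ρ`.
    have hreal := rpow_le_of_forall_le_add (m := m + 1) (Nat.succ_pos m) hp0 hpq hlam₂
      C₁.coe_nonneg (a := ρ ^ (ℓ + (m + 1)) * (M x).toReal) (b := ρ ^ (-lam) * B.toReal) (d := ρ ^ ℓ * ‖mollify φ g x‖)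
      (by positivity) (by positivity) (by positivity) (fun t ht => by
        have h1 := hC₁ ρ u g G hg hG φ hφ hφc hφ0 hφ1 x (t * ρ)
          ⟨mul_pos ht.1 hρ, mul_lt_of_lt_one_left hρ ht.2⟩
        have h2 := ENNReal.toReal_mono (by finiteness) h1
        rw [toReal_enorm, ENNReal.toReal_mul, ENNReal.toReal_add (by finiteness) (by finiteness),
          ENNReal.toReal_mul, ENNReal.toReal_mul, ENNReal.toReal_ofReal
            (pow_nonneg (mul_pos ht.1 hρ).le _), ENNReal.toReal_ofReal
            (Real.rpow_nonneg (mul_pos ht.1 hρ).le _), ENNReal.coe_toReal] at h2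
        calc ρ ^ ℓ * ‖mollify φ g x‖ ≤ ρ ^ ℓ * (C₁ * ((t * ρ) ^ (m + 1) * (M x).toReal +
              (t * ρ) ^ (-σ) * B.toReal)) := by gcongr
          _ = _ := by
            have h3 : ρ ^ (-lam) = ρ ^ ℓ * ρ ^ (-σ) := by
              rw [← Real.rpow_natCast, ← Real.rpow_add hρ]
              congr 1
              rw [hσ]; ring
            rw [h3, pow_add ρ, mul_pow, Real.mul_rpow ht.1.le hρ.le]
            ring)
    have hKr : (2 * (C₁ : ℝ)) ^ q + (C₁ * (1 + 2 ^ σ)) ^ (q - p) = (K : ℝ) := by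
      rw [hK]
      push_cast
      rfl
    have hMo : ENNReal.ofReal (M x).toReal = M x := ENNReal.ofReal_toReal hx.ne
    have hBo : ENNReal.ofReal B.toReal = B := ENNReal.ofReal_toReal hB.ne
    have hpow : ∀ (j : ℕ) (y s : ℝ), 0 ≤ y → 0 ≤ s → ENNReal.ofReal ((ρ ^ j * y) ^ s) =
        ENNReal.ofReal (ρ ^ ((j : ℝ) * s)) * ENNReal.ofReal y ^ s := by
      intro j y s hy hs
      rw [Real.mul_rpow (by positivity) hy, ENNReal.ofReal_mul (by positivity),
        ENNReal.ofReal_rpow_of_nonneg hy hs, ← Real.rpow_natCast, ← Real.rpow_mul hρ.le]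
    have hE := ENNReal.ofReal_le_ofReal hreal
    rw [hKr, ENNReal.ofReal_mul K.coe_nonneg, ENNReal.ofReal_coe_nnreal,
      ENNReal.ofReal_mul (by positivity), ENNReal.ofReal_add (by positivity) (by positivity),
      hpow _ _ _ (norm_nonneg _) hq0.le, hpow _ _ _ (norm_nonneg _) hp0.le,
      hpow _ _ _ ENNReal.toReal_nonneg hp0.le, ← ENNReal.ofReal_rpow_of_nonneg (by positivity) hqp.le,
      ENNReal.ofReal_mul (by positivity), hMo, hBo, ofReal_norm, ← mul_assoc] at hE
    exact hE
  have hfm : Measurable fun x => ‖mollify φ g x‖ₑ ^ p :=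
    (continuous_mollify hφ.continuous hφc hg.2.1).enorm.measurable.pow_const p
  have hbt : K * b ≠ ⊤ := by
    have : b < ⊤ := ENNReal.rpow_lt_top_of_nonneg hqp.le (by finiteness)
    finiteness
  calc _ ≤ ∫⁻ x, K * b * (ENNReal.ofReal (ρ ^ (((ℓ + (m + 1) : ℕ) : ℝ) * p)) * M x ^ p +
        ENNReal.ofReal (ρ ^ ((ℓ : ℝ) * p)) * ‖mollify φ g x‖ₑ ^ p) := lintegral_mono_ae hpt
    _ = K * b * (ENNReal.ofReal (ρ ^ (((ℓ + (m + 1) : ℕ) : ℝ) * p)) * (∫⁻ x, M x ^ p) +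
        ENNReal.ofReal (ρ ^ ((ℓ : ℝ) * p)) * ∫⁻ x, ‖mollify φ g x‖ₑ ^ p) := by
        rw [lintegral_const_mul' _ _ hbt, lintegral_add_right _ (hfm.const_mul _),
          lintegral_const_mul' _ _ ENNReal.ofReal_ne_top,
          lintegral_const_mul' _ _ ENNReal.ofReal_ne_top]
    _ ≤ K * b * (ENNReal.ofReal (ρ ^ (((ℓ + (m + 1) : ℕ) : ℝ) * p)) * ((C₂ + 1) * ∫⁻ x, ‖G x‖ₑ ^ p) +
        ENNReal.ofReal (ρ ^ ((ℓ : ℝ) * p)) * ((C₂ + 1) * ∫⁻ x, ‖g x‖ₑ ^ p)) := by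
        gcongr
        · refine hMp.trans ?_
          gcongr
          exact le_self_add
        · refine (lintegral_enorm_mollify_rpow_le hφ.continuous hφ0 hφi hφ1
            hg.2.1.aestronglyMeasurable hp.le).trans ?_
          exact le_mul_of_one_le_left' le_add_self
    _ = _ := by
        rw [lintegral_add_right' _ ((hg.2.1.aestronglyMeasurable.enorm.pow_const p).const_mul _),
          lintegral_const_mul' _ _ ENNReal.ofReal_ne_top,
          lintegral_const_mul' _ _ ENNReal.ofReal_ne_top]
        push_cast
        ring

theorem lintegral_enorm_rpow_lt_top_of_memLp {F : Type*} [NormedAddCommGroup F] {p : ℝ} (hp : 0 < p)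
    {g : 𝔼 → F} (hg : MemLp g (ENNReal.ofReal p)) : ∫⁻ x, ‖g x‖ₑ ^ p < ⊤ := by
  have := lintegral_rpow_enorm_lt_top_of_eLpNorm_lt_top (by simpa using hp) ENNReal.ofReal_ne_top
    hg.2
  rwa [ENNReal.toReal_ofReal hp.le] at this

end Interpolation

/-! ### Removal of the mollifier. -/

theorem theorem1 (N k ℓ : ℕ) (hk : 1 ≤ k) (hℓ : ℓ ≤ k - 1) (p q lam : ℝ)
    (hp : 1 < p) (hpq : p < q) (hlam₁ : -(ℓ : ℝ) ≤ lam)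
    (hlam₂ : lam ≤ ((k : ℝ) * p - (ℓ : ℝ) * q) / (q - p)) :
    ∃ C : ℝ≥0, ∀ ρ : ℝ, 0 < ρ → ∀ u : EuclideanSpace ℝ (Fin N) → ℝ,
      MemSobolev k p u → MemCampanato lam ℓ ρ u →
      ∀ (Dℓ : EuclideanSpace ℝ (Fin N) → (EuclideanSpace ℝ (Fin N)) [×ℓ]→L[ℝ] ℝ)
        (Dk : EuclideanSpace ℝ (Fin N) → (EuclideanSpace ℝ (Fin N)) [×k]→L[ℝ] ℝ),
        HasWeakDeriv ℓ u Dℓ → HasWeakDeriv k u Dk →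
        MemLp Dℓ (ENNReal.ofReal q) volume ∧
        ∫⁻ x, ENNReal.ofReal (ρ ^ ((ℓ : ℝ) * q)) * ‖Dℓ x‖ₑ ^ q ≤
          C * (ENNReal.ofReal (ρ ^ (-lam)) * campanatoSeminorm lam ℓ ρ u) ^ (q - p) *
            ∫⁻ x, (ENNReal.ofReal (ρ ^ ((k : ℝ) * p)) * ‖Dk x‖ₑ ^ p +
              ENNReal.ofReal (ρ ^ ((ℓ : ℝ) * p)) * ‖Dℓ x‖ₑ ^ p) := by
  have hp0 : 0 < p := one_pos.trans hp
  have hq0 : 0 < q := hp0.trans hpq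
  have hqp : 0 < q - p := sub_pos.2 hpq
  obtain ⟨m, rfl⟩ : ∃ m, k = ℓ + (m + 1) := ⟨k - 1 - ℓ, by omega⟩
  have hlam₃ : (ℓ + lam) * (q - p) ≤ p * (m + 1 : ℕ) := by
    rw [le_div_iff₀ hqp] at hlam₂
    push_cast at hlam₂ ⊢
    linarith
  obtain ⟨C, hC⟩ := exists_lintegral_mollify_rpow_le N ℓ m hp hpq hlam₁ hlam₃
  refine ⟨C, fun ρ hρ u hu hB Dℓ Dk hDℓ hDk => ?_⟩
  obtain ⟨gk, hgk, hgkp⟩ := hu.2 _ le_rfl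
  obtain ⟨gℓ, hgℓ, hgℓp⟩ := hu.2 ℓ (Nat.le_add_right _ _)
  -- Weak derivatives are unique almost everywhere, so the given ones inherit the `L^p` bounds from
  -- Sobolev membership.
  have hkfin : ∫⁻ x, ‖Dk x‖ₑ ^ p < ⊤ :=
    lintegral_enorm_rpow_lt_top_of_memLp hp0 (hgkp.ae_eq (hgk.ae_eq hDk))
  have hℓfin : ∫⁻ x, ‖Dℓ x‖ₑ ^ p < ⊤ :=
    lintegral_enorm_rpow_lt_top_of_memLp hp0 (hgℓp.ae_eq (hgℓ.ae_eq hDℓ))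
  -- The fixed ratio 2 of outer to inner radius is what the almost everywhere convergence needs for
  -- a merely locally integrable function.
  let φ : ℕ → ContDiffBump (0 : EuclideanSpace ℝ (Fin N)) := fun n =>
    ⟨1 / ((n : ℝ) + 1), 2 * (1 / ((n : ℝ) + 1)), by positivity, by
      have : (0 : ℝ) < 1 / ((n : ℝ) + 1) := by positivity
      linarith⟩
  have hlim : ∀ᵐ x, Filter.Tendsto (fun n => mollify ((φ n).normed volume) Dℓ x) Filter.atTop (nhds (Dℓ x)) := by
    refine ContDiffBump.ae_convolution_tendsto_right_of_locallyIntegrable (K := 2) ?_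
      (Filter.Eventually.of_forall fun n => le_rfl) hDℓ.2.1
    have h := (tendsto_one_div_add_atTop_nhds_zero_nat (𝕜 := ℝ)).const_mul 2
    rwa [mul_zero] at h
  have hbound := fun n => hC ρ hρ u Dℓ Dk hDℓ hDk hB.2 hkfin ((φ n).normed volume)
    (φ n).contDiff_normed (φ n).hasCompactSupport_normed (φ n).nonneg_normed (φ n).integral_normed
  have hmain : ∫⁻ x, ENNReal.ofReal (ρ ^ ((ℓ : ℝ) * q)) * ‖Dℓ x‖ₑ ^ q ≤
      C * (ENNReal.ofReal (ρ ^ (-lam)) * campanatoSeminorm lam ℓ ρ u) ^ (q - p) *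
        ∫⁻ x, (ENNReal.ofReal (ρ ^ (((ℓ + (m + 1) : ℕ) : ℝ) * p)) * ‖Dk x‖ₑ ^ p +
          ENNReal.ofReal (ρ ^ ((ℓ : ℝ) * p)) * ‖Dℓ x‖ₑ ^ p) := by
    calc _ ≤ ∫⁻ x, Filter.liminf (fun n => ENNReal.ofReal (ρ ^ ((ℓ : ℝ) * q)) *
          ‖mollify ((φ n).normed volume) Dℓ x‖ₑ ^ q) Filter.atTop := by
          refine lintegral_mono_ae ?_
          filter_upwards [hlim] with x hx
          refine (Filter.Tendsto.liminf_eq ?_).ge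
          exact ENNReal.Tendsto.const_mul (hx.enorm.ennrpow_const q) (Or.inr ENNReal.ofReal_ne_top)
      _ ≤ Filter.liminf (fun n => ∫⁻ x, ENNReal.ofReal (ρ ^ ((ℓ : ℝ) * q)) *
          ‖mollify ((φ n).normed volume) Dℓ x‖ₑ ^ q) Filter.atTop := by
          -- Fatou's lemma; the bound on the right does not depend on `n`.
          refine lintegral_liminf_le fun n => ?_
          exact ((continuous_mollify (φ n).continuous_normed (φ n).hasCompactSupport_normed
            hDℓ.2.1).enorm.measurable.pow_const q).const_mul _
      _ ≤ _ := by
          refine Filter.liminf_le_of_le (by isBoundedDefault) fun b hb => ?_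
          obtain ⟨n, hn⟩ := hb.exists
          exact hn.trans (hbound n)
  refine ⟨⟨hDℓ.2.1.aestronglyMeasurable, ?_⟩, hmain⟩
  rw [eLpNorm_lt_top_iff_lintegral_rpow_enorm_lt_top (by simpa using hq0) ENNReal.ofReal_ne_top,
    ENNReal.toReal_ofReal hq0.le]
  have hfin : ∫⁻ x, ENNReal.ofReal (ρ ^ ((ℓ : ℝ) * q)) * ‖Dℓ x‖ₑ ^ q < ⊤ := by
    refine hmain.trans_lt (ENNReal.mul_lt_top (ENNReal.mul_lt_top (by simp)
      (ENNReal.rpow_lt_top_of_nonneg hqp.le (ENNReal.mul_ne_top ENNReal.ofReal_ne_top hB.2.ne))) ?_)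
    rw [lintegral_add_right' _ ((hDℓ.2.1.aestronglyMeasurable.enorm.pow_const p).const_mul _),
      lintegral_const_mul' _ _ ENNReal.ofReal_ne_top,
      lintegral_const_mul' _ _ ENNReal.ofReal_ne_top]
    exact ENNReal.add_lt_top.2 ⟨ENNReal.mul_lt_top ENNReal.ofReal_lt_top hkfin,
      ENNReal.mul_lt_top ENNReal.ofReal_lt_top hℓfin⟩
  rw [lintegral_const_mul' _ _ ENNReal.ofReal_ne_top] at hfin
  refine ENNReal.lt_top_of_mul_ne_top_right hfin.ne ?_
  simpa using Real.rpow_pos_of_pos hρ _
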